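/- Let $\mathbb T=\mathbb R/2\pi\mathbb Z$ and let $D^{-2}=(1-\partial_x^2)^{-1}$ be the Fourier multiplier on $\mathbb T$ with symbol $1/(1+n^2)$. For $a,b\in\mathbb R$ consider the Cauchy problem for the cubic $ab$-family on the circle, $$u_t+u^2u_x-a\,u_x^3+D^{-2}\partial_x\Big[\tfrac b3u^3+\tfrac{6-6a-b}{2}\,u\,u_x^2\Big]+D^{-2}\Big[\tfrac{2a+b-2}{2}\,u_x^3\Big]=0,\qquad u(\cdot,0)=u_0 .$$ A solution in $H^s$ on $[0,T]$ with data $u_0\in H^s(\mathbb T)$ is a real-valued function $u\in C([0,T];H^s(\mathbb T))$ with $u(\cdot,t)\in L^1(\mathbb T)$ for every $t\in[0,T]$, with $u$ and its weak derivative $u_x$ in $L^3((0,T)\times\mathbb T)$, with $u(\cdot,0)=u_0$, that satisfies the equation in the sense of distributions on $(0,T)\times\mathbb T$. **Theorem.** Let $b\in\mathbb R$, $a\in\mathbb R\setminus\{0\}$ and $s<3/2$. Then solutions in $H^s$ of this Cauchy problem are not unique: there exist $T>0$, initial data $u_0\in H^s(\mathbb T)$, and two solutions $u,v$ in $H^s$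 on $[0,T]$, both with data $u_0$, such that $u(\cdot,t)\neq v(\cdot,t)$ (as elements of $L^1(\mathbb T)$) for some $t\in[0,T]$. -/

import Mathlib

open scoped ContDiff Topology
open MeasureTheory Real Filter

noncomputable section

namespace ABFamily

/-! The circle is `ℝ / 2πℤ`; functions on it are `2π`-periodic functions on `ℝ`. -/

/-- The `n`-th Fourier coefficient `(1/2π) ∫₀^{2π} f(x) e^{-inx} dx` of a function on the circle. -/
def coeff (f : ℝ → ℝ) (n : ℤ) : ℂ :=
  fourierCoeffOn Real.two_pi_pos (fun x => (f x : ℂ)) n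

/-- The `H^s` norm on the circle: `(∑ₙ (1 + n²)^s |f̂(n)|²)^{1/2}`. -/
def hsNorm (s : ℝ) (f : ℝ → ℝ) : ℝ :=
  Real.sqrt (∑' n : ℤ, (1 + (n : ℝ) ^ 2) ^ s * ‖coeff f n‖ ^ 2)

/-- The integrable function `f` on the circle belongs to the Sobolev space `H^s`. -/
structure MemHs (s : ℝ) (f : ℝ → ℝ) : Prop where
  periodic : Function.Periodic f (2 * π)
  integrable : IntervalIntegrable f volume 0 (2 * π)
  summable : Summable fun n : ℤ => (1 + (n : ℝ) ^ 2) ^ s * ‖coeff f n‖ ^ 2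

/-- `u ∈ C([0,T]; H^s)`. -/
structure ContinuousInHs (s T : ℝ) (u : ℝ → ℝ → ℝ) : Prop where
  mem : ∀ t ∈ Set.Icc 0 T, MemHs s (u t)
  tendsto : ∀ t₀ ∈ Set.Icc 0 T,
    Tendsto (fun t => hsNorm s (fun x => u t x - u t₀ x)) (𝓝[Set.Icc 0 T] t₀) (𝓝 0)

/-- The operator `D⁻² = (1 - ∂ₓ²)⁻¹` on integrable functions on the circle, i.e. the Fourier
multiplier `1 / (1 + n²)`. The series converges absolutely, and its sum is real. -/
def Dinv2 (f : ℝ → ℝ) (x : ℝ) : ℝ :=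
  (∑' n : ℤ, coeff f n / (1 + (n : ℂ) ^ 2) * Complex.exp (n * x * Complex.I)).re

/-- `g` is the weak derivative of `f` on the circle. -/
structure IsWeakDeriv (f g : ℝ → ℝ) : Prop where
  periodic_left : Function.Periodic f (2 * π)
  periodic_right : Function.Periodic g (2 * π)
  integrable_left : IntervalIntegrable f volume 0 (2 * π)
  integrable_right : IntervalIntegrable g volume 0 (2 * π)
  integral_eq : ∀ ψ : ℝ → ℝ, ContDiff ℝ ∞ ψ → Function.Periodic ψ (2 * π) →
    ∫ x in (0 : ℝ)..(2 * π), f x * deriv ψ x = -∫ x in (0 : ℝ)..(2 * π), g x * ψ x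

/-- Test functions: smooth functions on `(0,T) × circle` with compact support. -/
structure IsTest (T : ℝ) (φ : ℝ → ℝ → ℝ) : Prop where
  smooth : ContDiff ℝ ∞ (Function.uncurry φ)
  periodic : ∀ t, Function.Periodic (φ t) (2 * π)
  support : ∃ α β : ℝ, 0 < α ∧ β < T ∧ ∀ t, t ∉ Set.Icc α β → ∀ x, φ t x = 0

/-- The equation
`u_t + u² u_x - a u_x³ + D⁻² ∂ₓ[(b/3) u³ + ((6-6a-b)/2) u u_x²] + D⁻²[((2a+b-2)/2) u_x³] = 0`
holds in the sense of distributions on `(0,T) × circle`; `ux` stands for the derivative `u_x`. -/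
def EquationHolds (a b T : ℝ) (u ux : ℝ → ℝ → ℝ) : Prop :=
  ∀ φ : ℝ → ℝ → ℝ, IsTest T φ →
    ∫ t in (0 : ℝ)..T, ∫ x in (0 : ℝ)..(2 * π),
      (-(u t x * deriv (fun τ => φ τ x) t)
        + (u t x ^ 2 * ux t x - a * ux t x ^ 3) * φ t x
        - Dinv2 (fun y => b / 3 * u t y ^ 3 + (6 - 6 * a - b) / 2 * (u t y * ux t y ^ 2)) x
            * deriv (φ t) x
        + Dinv2 (fun y => (2 * a + b - 2) / 2 * ux t y ^ 3) x * φ t x) = 0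

/-- `u` is a solution on `[0,T]`, in `H^s`, of the Cauchy problem for the `ab`-family on the circle
with initial data `u₀`: it lies in `C([0,T]; H^s)`, has the value `u₀` at time `0`, and solves the
equation in the sense of distributions. For the cubic terms to make sense as integrable functions,
`u` and its weak derivative `u_x` are in `L³((0,T) × circle)`. -/
structure IsSolution (a b s T : ℝ) (u₀ : ℝ → ℝ) (u : ℝ → ℝ → ℝ) : Prop where
  continuous : ContinuousInHs s T u
  initial : u 0 =ᵐ[volume] u₀
  memL3 : MemLp (Function.uncurry u) 3
    (volume.restrict (Set.Ioo 0 T ×ˢ Set.Ioo 0 (2 * π)))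
  equation : ∃ ux : ℝ → ℝ → ℝ,
    MemLp (Function.uncurry ux) 3 (volume.restrict (Set.Ioo 0 T ×ˢ Set.Ioo 0 (2 * π))) ∧
    (∀ᵐ t ∂(volume.restrict (Set.Ioo 0 T)), IsWeakDeriv (u t) (ux t)) ∧
    EquationHolds a b T u ux

end ABFamily

end

namespace ABFamily

/-! A peakon can be read as two peakons sitting at the same point, and when `a ≠ 0` such a pair can
pull apart. Let `g` be the periodic peakon. For `u = p₁ g(x - q₁) + p₂ g(x - q₂)` the equation
reduces to an ODE system for momenta and positions, whose vector field extends smoothly through `q₁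
= q₂`. Where the peaks meet, the speeds differ by `2 sinh² π · a (p₂² - p₁²)`. Take momenta with `p₁
+ p₂ = 1` that make this positive: the pair starts as the single peakon `g` and then splits, while
the travelling peakon of momentum one has the same data and never splits.

To check the equation at a fixed time, write it as `H + ∂ₓ D⁻² E + D⁻² R = 0`, with `H = u_t + u²
u_x - a u_x³`. Multiplied by `1 + n²` in Fourier space, this is a statement about integrals over a
period. Between peaks `u'' = u`, so the integrands are exact derivatives (`integral_segment`). Only
the jumps at the peaks remain, and the ODE system says that they vanish (`coeff_twoPeakon`).
Parseval's identity (`integral_eq_zero_of_coeff`) turns this into the weak form in space, and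
`MovingPeak.integral_peakFlux` supplies the weak time derivative.

The bound `s < 3/2` enters only through the decay `1 / (1 + n²)` of the coefficients of `g`. The
split pair is obtained in `exists_splitting_flow` and told apart from one peakon in
`superpose_not_ae_eq_single`. -/

/-! ### Bounded measurable functions -/

/-- Bounded measurable real functions. -/
structure BoundedMeasurable (f : ℝ → ℝ) : Prop where
  measurable : Measurable f
  bounded : ∃ C, ∀ x, |f x| ≤ C

namespace BoundedMeasurable

variable {f g : ℝ → ℝ}

theorem const (c : ℝ) : BoundedMeasurable fun _ => c :=
  ⟨measurable_const, |c|, fun _ => le_rfl⟩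

theorem add (hf : BoundedMeasurable f) (hg : BoundedMeasurable g) :
    BoundedMeasurable fun x => f x + g x := by
  obtain ⟨C, hC⟩ := hf.bounded
  obtain ⟨D, hD⟩ := hg.bounded
  exact ⟨hf.measurable.add hg.measurable, C + D, fun x =>
    (abs_add_le _ _).trans (add_le_add (hC x) (hD x))⟩

theorem mul (hf : BoundedMeasurable f) (hg : BoundedMeasurable g) :
    BoundedMeasurable fun x => f x * g x := by
  obtain ⟨C, hC⟩ := hf.bounded
  obtain ⟨D, hD⟩ := hg.bounded
  refine ⟨hf.measurable.mul hg.measurable, C * D, fun x => ?_⟩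
  rw [abs_mul]
  exact mul_le_mul (hC x) (hD x) (abs_nonneg _) ((abs_nonneg _).trans (hC x))

theorem sub (hf : BoundedMeasurable f) (hg : BoundedMeasurable g) :
    BoundedMeasurable fun x => f x - g x := by
  simpa [sub_eq_add_neg] using hf.add ((const (-1)).mul hg)

theorem pow (hf : BoundedMeasurable f) (n : ℕ) : BoundedMeasurable fun x => f x ^ n := by
  obtain ⟨C, hC⟩ := hf.bounded
  refine ⟨hf.measurable.pow_const n, C ^ n, fun x => ?_⟩
  rw [abs_pow]
  exact pow_le_pow_left₀ (abs_nonneg _) (hC x) n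

theorem comp_sub (hf : BoundedMeasurable f) (q : ℝ) : BoundedMeasurable fun x => f (x - q) := by
  obtain ⟨C, hC⟩ := hf.bounded
  exact ⟨hf.measurable.comp (measurable_id.sub_const q), C, fun x => hC _⟩

theorem memLp (hf : BoundedMeasurable f) (p : ENNReal) (μ : Measure ℝ) [IsFiniteMeasure μ] :
    MemLp f p μ := by
  obtain ⟨C, hC⟩ := hf.bounded
  exact MemLp.of_bound hf.measurable.aestronglyMeasurable C (.of_forall hC)

theorem intervalIntegrable_mul (hf : BoundedMeasurable f) {φ : ℝ → ℂ} (hφ : Continuous φ)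
    (l r : ℝ) : IntervalIntegrable (fun x => (f x : ℂ) * φ x) volume l r := by
  obtain ⟨C, hC⟩ := hf.bounded
  rw [intervalIntegrable_iff]
  refine Integrable.bdd_mul (c := C) (intervalIntegrable_iff.1 (hφ.intervalIntegrable l r))
    (Complex.measurable_ofReal.comp hf.measurable).aestronglyMeasurable (.of_forall fun x => ?_)
  simpa using hC x

theorem intervalIntegrable_mul_real (hf : BoundedMeasurable f) {φ : ℝ → ℝ} (hφ : Continuous φ)
    (l r : ℝ) : IntervalIntegrable (fun x => f x * φ x) volume l r := by
  obtain ⟨C, hC⟩ := hf.bounded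
  rw [intervalIntegrable_iff]
  exact Integrable.bdd_mul (c := C) (intervalIntegrable_iff.1 (hφ.intervalIntegrable l r))
    hf.measurable.aestronglyMeasurable (.of_forall fun x => hC x)

theorem intervalIntegrable (hf : BoundedMeasurable f) (l r : ℝ) :
    IntervalIntegrable f volume l r := by
  simpa using hf.intervalIntegrable_mul_real (continuous_const (y := (1 : ℝ))) l r

end BoundedMeasurable

theorem _root_.Continuous.memLp_Ioc {f : ℝ → ℝ} (hf : Continuous f) (p : ENNReal) (l r : ℝ) :
    MemLp f p (volume.restrict (Set.Ioc l r)) := by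
  obtain ⟨C, hC⟩ := isCompact_Icc.exists_bound_of_continuousOn (s := Set.Icc l r) hf.continuousOn
  refine MemLp.of_bound hf.aestronglyMeasurable C ?_
  filter_upwards [ae_restrict_mem measurableSet_Ioc] with x hx using hC x (Set.Ioc_subset_Icc_self hx)

/-! ### Fourier coefficients -/

theorem coeff_eq (f : ℝ → ℝ) (n : ℤ) :
    coeff f n = 1 / (2 * π) * ∫ x in (0 : ℝ)..(2 * π), (f x : ℂ) * Complex.exp (-(n * Complex.I) * x) := by
  rw [coeff, fourierCoeffOn_eq_integral, Complex.real_smul]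
  congr 1
  · push_cast; ring
  · refine intervalIntegral.integral_congr fun x _ => ?_
    simp only [fourier_coe_apply, smul_eq_mul]
    rw [mul_comm]
    congr 2
    push_cast
    have : (π : ℂ) ≠ 0 := by exact_mod_cast pi_ne_zero
    field_simp
    ring

theorem continuous_cexp_mul (k : ℂ) : Continuous fun x : ℝ => Complex.exp (k * x) := by fun_prop

theorem intervalIntegrable_ofReal {f : ℝ → ℝ} {l r : ℝ} (hf : IntervalIntegrable f volume l r) :
    IntervalIntegrable (fun x => (f x : ℂ)) volume l r :=
  ⟨hf.1.ofReal, hf.2.ofReal⟩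

theorem coeff_add {f g : ℝ → ℝ} (hf : IntervalIntegrable f volume 0 (2 * π))
    (hg : IntervalIntegrable g volume 0 (2 * π)) (n : ℤ) :
    coeff (fun x => f x + g x) n = coeff f n + coeff g n := by
  rw [coeff_eq, coeff_eq, coeff_eq, ← mul_add, ← intervalIntegral.integral_add]
  · congr 1
    refine intervalIntegral.integral_congr fun x _ => ?_
    push_cast; ring
  · exact IntervalIntegrable.mul_continuousOn (intervalIntegrable_ofReal hf) (continuous_cexp_mul _).continuousOn
  · exact IntervalIntegrable.mul_continuousOn (intervalIntegrable_ofReal hg) (continuous_cexp_mul _).continuousOn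

theorem coeff_const_mul (c : ℝ) (f : ℝ → ℝ) (n : ℤ) :
    coeff (fun x => c * f x) n = c * coeff f n := by
  rw [coeff_eq, coeff_eq, mul_left_comm, ← intervalIntegral.integral_const_mul (c : ℂ)]
  congr 1
  refine intervalIntegral.integral_congr fun x _ => ?_
  push_cast; ring

theorem coeff_sub {f g : ℝ → ℝ} (hf : IntervalIntegrable f volume 0 (2 * π))
    (hg : IntervalIntegrable g volume 0 (2 * π)) (n : ℤ) :
    coeff (fun x => f x - g x) n = coeff f n - coeff g n := by
  have h := coeff_add hf (hg.const_mul (-1)) n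
  rw [coeff_const_mul] at h
  simpa [sub_eq_add_neg] using h

theorem coeff_congr_ae {f g : ℝ → ℝ} (h : f =ᵐ[volume] g) (n : ℤ) : coeff f n = coeff g n := by
  refine congrFun (fourierCoeffOn_congr_ae _ (ae_restrict_of_ae ?_)) n
  filter_upwards [h] with x hx
  simp [hx]

theorem cexp_int_period (n : ℤ) : Complex.exp (-(n * Complex.I) * ((2 * π : ℝ) : ℂ)) = 1 := by
  rw [Complex.exp_eq_one_iff]
  exact ⟨-n, by push_cast; ring⟩

theorem coeff_deriv {φ : ℝ → ℝ} (hφ : ContDiff ℝ ∞ φ) (hp : Function.Periodic φ (2 * π)) (n : ℤ) :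
    coeff (deriv φ) n = n * Complex.I * coeff φ n := by
  set k : ℂ := -(n * Complex.I) with hk
  have hd : ∀ x : ℝ, HasDerivAt (fun x : ℝ => (φ x : ℂ) * Complex.exp (k * x))
      (((deriv φ x : ℝ) : ℂ) * Complex.exp (k * x) + k * (φ x * Complex.exp (k * x))) x := by
    intro x
    have h1 := HasDerivAt.ofReal_comp (hφ.differentiable (by simp) x).hasDerivAt
    have h2 : HasDerivAt (fun x : ℝ => Complex.exp (k * x)) (Complex.exp (k * x) * (k * 1)) x :=
      ((Complex.ofRealCLM.hasDerivAt (x := x)).const_mul k).cexp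
    exact (h1.mul h2).congr_deriv (by ring)
  have hc : Continuous fun x : ℝ => (φ x : ℂ) * Complex.exp (k * x) := by
    have := hφ.continuous
    fun_prop
  have hc' : Continuous fun x : ℝ => ((deriv φ x : ℝ) : ℂ) * Complex.exp (k * x) := by
    have := hφ.continuous_deriv (by simp)
    fun_prop
  have h := intervalIntegral.integral_eq_sub_of_hasDerivAt (fun x _ => hd x)
    ((hc'.add (hc.const_mul k)).intervalIntegrable 0 (2 * π))
  rw [intervalIntegral.integral_add (hc'.intervalIntegrable _ _)
    ((hc.const_mul k).intervalIntegrable _ _), intervalIntegral.integral_const_mul] at h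
  have h0 : φ (2 * π) = φ 0 := by simpa using hp 0
  rw [cexp_int_period, h0] at h
  simp only [Complex.ofReal_zero, mul_zero, Complex.exp_zero, sub_self] at h
  rw [coeff_eq, coeff_eq, eq_neg_of_add_eq_zero_left h, hk]
  ring

/-- Parseval's identity for real functions, polarised. -/
theorem hasSum_coeff_mul_conj {f g : ℝ → ℝ} (hf : MemLp f 2 (volume.restrict (Set.Ioc 0 (2 * π))))
    (hg : MemLp g 2 (volume.restrict (Set.Ioc 0 (2 * π)))) :
    HasSum (fun n => (coeff f n * (starRingEnd ℂ) (coeff g n)).re)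
      ((2 * π)⁻¹ * ∫ x in (0 : ℝ)..(2 * π), f x * g x) := by
  have key : ∀ h : ℝ → ℝ, MemLp h 2 (volume.restrict (Set.Ioc 0 (2 * π))) →
      HasSum (fun n => ‖coeff h n‖ ^ 2) ((2 * π)⁻¹ * ∫ x in (0 : ℝ)..(2 * π), h x ^ 2) := by
    intro h hh
    have := hasSum_sq_fourierCoeffOn Real.two_pi_pos hh.ofReal
    simpa [coeff] using this
  have hint : ∀ h : ℝ → ℝ, MemLp h 2 (volume.restrict (Set.Ioc 0 (2 * π))) →
      IntervalIntegrable h volume 0 (2 * π) := fun h hh => by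
    rw [intervalIntegrable_iff_integrableOn_Ioc_of_le Real.two_pi_pos.le]
    exact hh.integrable (by norm_num)
  have hsq : ∀ h : ℝ → ℝ, MemLp h 2 (volume.restrict (Set.Ioc 0 (2 * π))) →
      IntervalIntegrable (fun x => h x ^ 2) volume 0 (2 * π) := fun h hh => by
    rw [intervalIntegrable_iff_integrableOn_Ioc_of_le Real.two_pi_pos.le]
    exact hh.integrable_sq
  have hs := ((key _ (hf.add hg)).sub (key _ (hf.sub hg))).mul_left (1 / 4)
  have e0 : (fun n => (coeff f n * (starRingEnd ℂ) (coeff g n)).re) =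
      fun n => 1 / 4 * (‖coeff (f + g) n‖ ^ 2 - ‖coeff (f - g) n‖ ^ 2) := by
    funext n
    have e1 : coeff (f + g) n = coeff f n + coeff g n := coeff_add (hint f hf) (hint g hg) n
    have e2 : coeff (f - g) n = coeff f n - coeff g n := coeff_sub (hint f hf) (hint g hg) n
    rw [e1, e2, Complex.sq_norm, Complex.sq_norm, Complex.normSq_add, Complex.normSq_sub]
    ring
  have e3 : (2 * π)⁻¹ * ∫ x in (0 : ℝ)..(2 * π), f x * g x =
      1 / 4 * (((2 * π)⁻¹ * ∫ x in (0 : ℝ)..(2 * π), (f + g) x ^ 2)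
        - (2 * π)⁻¹ * ∫ x in (0 : ℝ)..(2 * π), (f - g) x ^ 2) := by
    rw [← mul_sub, ← intervalIntegral.integral_sub (hsq _ (hf.add hg)) (hsq _ (hf.sub hg)),
      ← mul_assoc, mul_comm (1 / 4) (2 * π)⁻¹, mul_assoc, ← intervalIntegral.integral_const_mul (1 / 4 : ℝ)]
    congr 1
    refine intervalIntegral.integral_congr fun x _ => ?_
    simp only [Pi.add_apply, Pi.sub_apply]
    ring
  rwa [e0, e3]

/-! ### The operator `D⁻²` -/

theorem summable_inv_one_add_sq : Summable fun n : ℤ => (1 + (n : ℝ) ^ 2)⁻¹ := by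
  -- Division by zero makes `1 / n²` vanish at `n = 0`, so the comparison series gets an extra `1`
  -- there.
  refine Summable.of_nonneg_of_le (fun n => by positivity) (fun n => ?_)
    ((Real.summable_one_div_int_pow (p := 2)).2 (by norm_num) |>.add
      (summable_of_ne_finset_zero (s := {0}) (f := fun n : ℤ => if n = 0 then (1 : ℝ) else 0)
        (by intro n hn; simpa using hn)))
  by_cases hn : n = 0
  · simp [hn]
  · simp only [hn, if_false, add_zero, one_div]
    have : (0 : ℝ) < (n : ℝ) ^ 2 := by positivity
    gcongr
    linarith

theorem norm_one_add_sq (n : ℤ) : ‖(1 + (n : ℂ) ^ 2)‖ = 1 + (n : ℝ) ^ 2 := by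
  have : (1 + (n : ℂ) ^ 2) = ((1 + (n : ℝ) ^ 2 : ℝ) : ℂ) := by push_cast; ring
  rw [this, Complex.norm_real, Real.norm_of_nonneg (by positivity)]

theorem one_add_sq_ne_zero (n : ℤ) : (1 + (n : ℂ) ^ 2) ≠ 0 := by
  rw [← norm_ne_zero_iff, norm_one_add_sq]
  positivity

theorem norm_cexp_int (n : ℤ) (x : ℝ) : ‖Complex.exp (n * x * Complex.I)‖ = 1 := by
  have := Complex.norm_exp_ofReal_mul_I (n * x)
  push_cast at this
  exact this

theorem norm_coeff_le {f : ℝ → ℝ} (hf : BoundedMeasurable f) : ∃ C, ∀ n, ‖coeff f n‖ ≤ C := by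
  obtain ⟨C, hC⟩ := hf.bounded
  refine ⟨C, fun n => ?_⟩
  have h : ‖∫ x in (0 : ℝ)..(2 * π), (f x : ℂ) * Complex.exp (-(n * Complex.I) * x)‖
      ≤ C * |2 * π - 0| := by
    refine intervalIntegral.norm_integral_le_of_norm_le_const fun x _ => ?_
    have : -(n * Complex.I) * x = ((-n : ℤ) : ℂ) * x * Complex.I := by push_cast; ring
    rw [norm_mul, this, norm_cexp_int, mul_one]
    simpa using hC x
  rw [sub_zero, abs_of_pos Real.two_pi_pos] at h
  rw [coeff_eq, norm_mul]
  have h2 : ‖(1 / (2 * π) : ℂ)‖ = (2 * π)⁻¹ := by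
    simp [abs_of_pos pi_pos]
  rw [h2, inv_mul_le_iff₀ Real.two_pi_pos]
  linarith

theorem summable_norm_dinv2 {f : ℝ → ℝ} (hf : BoundedMeasurable f) :
    Summable fun n : ℤ => ‖coeff f n / (1 + (n : ℂ) ^ 2)‖ := by
  obtain ⟨C, hC⟩ := norm_coeff_le hf
  refine Summable.of_nonneg_of_le (fun n => norm_nonneg _) (fun n => ?_)
    (summable_inv_one_add_sq.mul_left C)
  rw [norm_div, norm_one_add_sq, div_eq_mul_inv]
  exact mul_le_mul_of_nonneg_right (hC n) (by positivity)

theorem continuous_dinv2 {f : ℝ → ℝ} (hf : BoundedMeasurable f) : Continuous (Dinv2 f) := by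
  refine Complex.continuous_re.comp (continuous_tsum (fun n => by fun_prop)
    (summable_norm_dinv2 hf) fun n x => ?_)
  rw [norm_mul, norm_cexp_int, mul_one]

/-- The multiplier series converges absolutely and uniformly, so it may be integrated against `ψ`
term by term. The coefficients of `Dinv2 f` itself are never needed. -/
theorem hasSum_dinv2_mul {f ψ : ℝ → ℝ} (hf : BoundedMeasurable f) (hψ : Continuous ψ) :
    HasSum (fun n : ℤ => (coeff f n / (1 + (n : ℂ) ^ 2) * (starRingEnd ℂ) (coeff ψ n)).re)
      ((2 * π)⁻¹ * ∫ x in (0 : ℝ)..(2 * π), Dinv2 f x * ψ x) := by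
  obtain ⟨M, hM⟩ := isCompact_Icc.exists_bound_of_continuousOn
    (s := Set.Icc 0 (2 * π)) hψ.continuousOn
  have hsum := summable_norm_dinv2 hf
  have hS : ∀ x : ℝ, Summable fun n : ℤ =>
      coeff f n / (1 + (n : ℂ) ^ 2) * Complex.exp (n * x * Complex.I) := fun x => by
    refine Summable.of_norm ?_
    simpa only [norm_mul, norm_cexp_int, mul_one] using hsum
  have h := intervalIntegral.hasSum_integral_of_dominated_convergence (μ := volume)
    (a := 0) (b := 2 * π)
    (F := fun (n : ℤ) (x : ℝ) => coeff f n / (1 + (n : ℂ) ^ 2) *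
      Complex.exp (n * x * Complex.I) * (ψ x : ℂ))
    (f := fun x => (∑' n : ℤ, coeff f n / (1 + (n : ℂ) ^ 2) *
      Complex.exp (n * x * Complex.I)) * (ψ x : ℂ))
    (fun n _ => ‖coeff f n / (1 + (n : ℂ) ^ 2)‖ * M)
    (fun n => by
      have : Continuous fun x : ℝ => coeff f n / (1 + (n : ℂ) ^ 2) *
          Complex.exp (n * x * Complex.I) * (ψ x : ℂ) := by fun_prop
      exact this.aestronglyMeasurable)
    (fun n => .of_forall fun x hx => by
      rw [Set.uIoc_of_le Real.two_pi_pos.le] at hx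
      rw [norm_mul, norm_mul, norm_cexp_int, mul_one]
      have := hM x (Set.Ioc_subset_Icc_self hx)
      rw [Complex.norm_real]
      gcongr)
    (.of_forall fun x _ => hsum.mul_right M)
    (by simp)
    (.of_forall fun x _ => (hS x).hasSum.mul_right _)
  have hcont : Continuous fun x : ℝ => (∑' n : ℤ, coeff f n / (1 + (n : ℂ) ^ 2) *
      Complex.exp (n * x * Complex.I)) * (ψ x : ℂ) := by
    refine Continuous.mul (continuous_tsum (fun n => by fun_prop) hsum fun n x => ?_) (by fun_prop)
    rw [norm_mul, norm_cexp_int, mul_one]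
  have h2 := (Complex.hasSum_re h).mul_left (2 * π)⁻¹
  have e : (∫ x in (0 : ℝ)..(2 * π), (∑' n : ℤ, coeff f n / (1 + (n : ℂ) ^ 2) *
      Complex.exp (n * x * Complex.I)) * (ψ x : ℂ)).re
      = ∫ x in (0 : ℝ)..(2 * π), Dinv2 f x * ψ x := by
    have := Complex.reCLM.intervalIntegral_comp_comm (hcont.intervalIntegrable (μ := volume) 0 (2 * π))
    simp only [Complex.reCLM_apply] at this
    rw [← this]
    refine intervalIntegral.integral_congr fun x _ => ?_
    simp [Dinv2]
  rw [e] at h2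
  have e2 : (fun n : ℤ => (coeff f n / (1 + (n : ℂ) ^ 2) * (starRingEnd ℂ) (coeff ψ n)).re) =
      fun n : ℤ => (2 * π)⁻¹ * (∫ x in (0 : ℝ)..(2 * π), coeff f n / (1 + (n : ℂ) ^ 2) *
        Complex.exp (n * x * Complex.I) * (ψ x : ℂ)).re := ?_
  · rwa [e2]
  funext n
  have e3 : (starRingEnd ℂ) (coeff ψ n) = ((2 * π)⁻¹ : ℝ) *
      ∫ x in (0 : ℝ)..(2 * π), Complex.exp (n * x * Complex.I) * (ψ x : ℂ) := by
    rw [coeff_eq, map_mul, ← intervalIntegral.intervalIntegral_conj]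
    congr 1
    · simp [map_ofNat]
    · refine intervalIntegral.integral_congr fun x _ => ?_
      simp only [map_mul, Complex.conj_ofReal, ← Complex.exp_conj, map_neg, Complex.conj_I,
        map_intCast]
      rw [mul_comm]
      congr 2
      ring
  simp only [mul_assoc]
  rw [e3, mul_left_comm, Complex.re_ofReal_mul, ← intervalIntegral.integral_const_mul]
  simp only [mul_assoc]

/-- If `(1 + n²) Ĥ(n) + i n Ê(n) + R̂(n) = 0` for all `n`, then `H + ∂ₓ D⁻² E + D⁻² R = 0` weakly. -/
theorem integral_eq_zero_of_coeff {H E R φ : ℝ → ℝ} (hH : BoundedMeasurable H)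
    (hE : BoundedMeasurable E) (hR : BoundedMeasurable R) (hφ : ContDiff ℝ ∞ φ)
    (hp : Function.Periodic φ (2 * π))
    (h : ∀ n : ℤ, (1 + (n : ℂ) ^ 2) * coeff H n + n * Complex.I * coeff E n + coeff R n = 0) :
    (∫ x in (0 : ℝ)..(2 * π), H x * φ x) - (∫ x in (0 : ℝ)..(2 * π), Dinv2 E x * deriv φ x)
      + (∫ x in (0 : ℝ)..(2 * π), Dinv2 R x * φ x) = 0 := by
  have h1 := hasSum_coeff_mul_conj (hH.memLp 2 _) (hφ.continuous.memLp_Ioc 2 0 (2 * π))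
  have h2 := hasSum_dinv2_mul hE (hφ.continuous_deriv (by simp))
  have h3 := hasSum_dinv2_mul hR hφ.continuous
  have h4 := (h1.sub h2).add h3
  have h5 : ∀ n : ℤ, (coeff H n * (starRingEnd ℂ) (coeff φ n)).re
      - (coeff E n / (1 + (n : ℂ) ^ 2) * (starRingEnd ℂ) (coeff (deriv φ) n)).re
      + (coeff R n / (1 + (n : ℂ) ^ 2) * (starRingEnd ℂ) (coeff φ n)).re = 0 := by
    intro n
    rw [coeff_deriv hφ hp, ← Complex.sub_re, ← Complex.add_re]
    simp only [map_mul, Complex.conj_I, map_intCast]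
    -- Conjugating `i n φ̂(n)` flips the sign of `i`, which absorbs the minus sign from moving `∂ₓ`
    -- onto `φ`; the hypothesis then factors out.
    have e : coeff H n * (starRingEnd ℂ) (coeff φ n)
        - coeff E n / (1 + (n : ℂ) ^ 2) * (n * -Complex.I * (starRingEnd ℂ) (coeff φ n))
        + coeff R n / (1 + (n : ℂ) ^ 2) * (starRingEnd ℂ) (coeff φ n)
        = ((1 + (n : ℂ) ^ 2) * coeff H n + n * Complex.I * coeff E n + coeff R n)
          * ((starRingEnd ℂ) (coeff φ n) / (1 + (n : ℂ) ^ 2)) := by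
      have := one_add_sq_ne_zero n
      field_simp
      ring
    rw [e, h n]
    simp
  simp only [h5] at h4
  have h6 := h4.unique hasSum_zero
  rw [← mul_sub, ← mul_add] at h6
  exact (mul_eq_zero.1 h6).resolve_left (inv_ne_zero Real.two_pi_pos.ne')

/-! ### Periodic peakons -/

/-- The representative of `x` modulo `2π` in `[0, 2π)`, shifted by `-π`. -/
noncomputable def centred (x : ℝ) : ℝ := 2 * π * Int.fract (x / (2 * π)) - π

/-- The periodic peakon, equal to `cosh (x - π)` on `[0, 2π]`. -/
noncomputable def peakon (x : ℝ) : ℝ := cosh (centred x)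

/-- The derivative of the periodic peakon, equal to `sinh (x - π)` on `(0, 2π)`. -/
noncomputable def peakonDeriv (x : ℝ) : ℝ := sinh (centred x)

theorem centred_periodic : Function.Periodic centred (2 * π) := fun x => by
  have : (x + 2 * π) / (2 * π) = x / (2 * π) + 1 := by
    have := Real.two_pi_pos.ne'
    field_simp
  simp [centred, this]

theorem measurable_centred : Measurable centred := by
  unfold centred
  fun_prop

theorem abs_centred_le (x : ℝ) : |centred x| ≤ π := by
  have h0 := Int.fract_nonneg (x / (2 * π))
  have h1 := (Int.fract_lt_one (x / (2 * π))).le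
  have := pi_pos
  rw [centred, abs_le]
  constructor <;> nlinarith

theorem centred_of_pos {x : ℝ} (h0 : 0 < x) (h1 : x < 2 * π) : centred x = x - π := by
  have := Real.two_pi_pos
  have h : Int.fract (x / (2 * π)) = x / (2 * π) :=
    Int.fract_eq_self.2 ⟨by positivity, by rwa [div_lt_one this]⟩
  rw [centred, h, mul_div_cancel₀ _ this.ne']

theorem centred_of_neg {x : ℝ} (h0 : -(2 * π) < x) (h1 : x < 0) : centred x = x + π := by
  rw [← centred_periodic, centred_of_pos (by linarith) (by linarith)]
  ring

theorem peakon_periodic : Function.Periodic peakon (2 * π) := fun x => by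
  rw [peakon, peakon, centred_periodic]

theorem peakonDeriv_periodic : Function.Periodic peakonDeriv (2 * π) := fun x => by
  rw [peakonDeriv, peakonDeriv, centred_periodic]

theorem boundedMeasurable_peakon : BoundedMeasurable peakon :=
  ⟨Real.measurable_cosh.comp measurable_centred, cosh π, fun x => by
    rw [peakon, abs_of_pos (cosh_pos _), cosh_le_cosh, abs_of_pos pi_pos]
    exact abs_centred_le x⟩

theorem boundedMeasurable_peakonDeriv : BoundedMeasurable peakonDeriv :=
  ⟨Real.measurable_sinh.comp measurable_centred, sinh π, fun x => by
    rw [peakonDeriv, abs_sinh, sinh_le_sinh]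
    exact abs_centred_le x⟩

theorem periodic_comp_sub {f : ℝ → ℝ} {c : ℝ} (hf : Function.Periodic f c) (q : ℝ) :
    Function.Periodic (fun x => f (x - q)) c := fun x => by
  change f (x + c - q) = f (x - q)
  rw [add_sub_right_comm, hf]

theorem integral_period_eq {E : Type*} [NormedAddCommGroup E] [NormedSpace ℝ E] {f : ℝ → E}
    (hf : Function.Periodic f (2 * π)) (q : ℝ) :
    ∫ x in (0 : ℝ)..(2 * π), f x = ∫ x in q..(q + 2 * π), f x := by
  simpa using hf.intervalIntegral_add_eq 0 q

theorem integral_comp_sub_mul {f ψ : ℝ → ℝ} (hf : Function.Periodic f (2 * π))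
    (hψ : Function.Periodic ψ (2 * π)) (q : ℝ) :
    ∫ x in (0 : ℝ)..(2 * π), f (x - q) * ψ x = ∫ y in (0 : ℝ)..(2 * π), f y * ψ (y + q) := by
  rw [integral_period_eq (f := fun x => f (x - q) * ψ x) ((periodic_comp_sub hf q).mul hψ) q]
  have := intervalIntegral.integral_comp_add_right (a := 0) (b := 2 * π)
    (fun x => f (x - q) * ψ x) q
  simp only [add_sub_cancel_right, zero_add] at this
  rw [this, add_comm]

/-- Integration by parts over one period leaves no boundary term, because `cosh` takes the same
value at `π` and `-π` and `ψ` is periodic. -/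
theorem integral_peakon_mul_deriv {ψ : ℝ → ℝ} (hψ : ContDiff ℝ 1 ψ)
    (hp : Function.Periodic ψ (2 * π)) :
    ∫ x in (0 : ℝ)..(2 * π), peakon x * deriv ψ x
      = -∫ x in (0 : ℝ)..(2 * π), peakonDeriv x * ψ x := by
  have e1 : ∫ x in (0 : ℝ)..(2 * π), peakon x * deriv ψ x
      = ∫ x in (0 : ℝ)..(2 * π), cosh (x - π) * deriv ψ x :=
    intervalIntegral.integral_congr_Ioo_of_le Real.two_pi_pos.le fun x hx => by
      simp only [peakon, centred_of_pos hx.1 hx.2]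
  have e2 : ∫ x in (0 : ℝ)..(2 * π), peakonDeriv x * ψ x
      = ∫ x in (0 : ℝ)..(2 * π), sinh (x - π) * ψ x :=
    intervalIntegral.integral_congr_Ioo_of_le Real.two_pi_pos.le fun x hx => by
      simp only [peakonDeriv, centred_of_pos hx.1 hx.2]
  have hc : ∀ x : ℝ, HasDerivAt (fun x => cosh (x - π)) (sinh (x - π)) x := fun x => by
    simpa using ((hasDerivAt_id x).sub_const π).cosh
  have h0 : ψ (2 * π) = ψ 0 := by simpa using hp 0
  rw [e1, e2, intervalIntegral.integral_mul_deriv_eq_deriv_mul (fun x _ => hc x)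
    (fun x _ => (hψ.differentiable (by simp) x).hasDerivAt)
    (Continuous.intervalIntegrable (by fun_prop) _ _)
    ((hψ.continuous_deriv le_rfl).intervalIntegrable _ _), h0]
  have : (2 : ℝ) * π - π = π := by ring
  rw [this, zero_sub, cosh_neg, sub_self, zero_sub]

theorem isWeakDeriv_peakon (q : ℝ) :
    IsWeakDeriv (fun x => peakon (x - q)) fun x => peakonDeriv (x - q) where
  periodic_left := periodic_comp_sub peakon_periodic q
  periodic_right := periodic_comp_sub peakonDeriv_periodic q
  integrable_left := (boundedMeasurable_peakon.comp_sub q).intervalIntegrable _ _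
  integrable_right := (boundedMeasurable_peakonDeriv.comp_sub q).intervalIntegrable _ _
  integral_eq ψ hψ hp := by
    have hdp : Function.Periodic (deriv ψ) (2 * π) := fun x => by
      rw [← deriv_comp_add_const, funext hp]
    have hsp : Function.Periodic (fun y => ψ (y + q)) (2 * π) := fun x => by
      change ψ (x + 2 * π + q) = ψ (x + q)
      rw [add_right_comm, hp]
    rw [integral_comp_sub_mul peakon_periodic hdp, integral_comp_sub_mul peakonDeriv_periodic hp,
      ← integral_peakon_mul_deriv (ψ := fun y => ψ (y + q))
        ((hψ.of_le (by simp)).comp (contDiff_id.add contDiff_const)) hsp]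
    simp only [deriv_comp_add_const]

theorem IsWeakDeriv.const_mul {f g : ℝ → ℝ} (h : IsWeakDeriv f g) (c : ℝ) :
    IsWeakDeriv (fun x => c * f x) fun x => c * g x where
  periodic_left x := congrArg (c * ·) (h.periodic_left x)
  periodic_right x := congrArg (c * ·) (h.periodic_right x)
  integrable_left := h.integrable_left.const_mul c
  integrable_right := h.integrable_right.const_mul c
  integral_eq ψ hψ hp := by
    simp only [mul_assoc, intervalIntegral.integral_const_mul, h.integral_eq ψ hψ hp, mul_neg]

theorem IsWeakDeriv.add {f g f' g' : ℝ → ℝ} (hf : IsWeakDeriv f f') (hg : IsWeakDeriv g g') :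
    IsWeakDeriv (fun x => f x + g x) fun x => f' x + g' x where
  periodic_left := hf.periodic_left.add hg.periodic_left
  periodic_right := hf.periodic_right.add hg.periodic_right
  integrable_left := hf.integrable_left.add hg.integrable_left
  integrable_right := hf.integrable_right.add hg.integrable_right
  integral_eq ψ hψ hp := by
    have c := hψ.continuous.continuousOn (s := Set.uIcc 0 (2 * π))
    have c' := (hψ.continuous_deriv (by simp)).continuousOn (s := Set.uIcc 0 (2 * π))
    simp only [add_mul]
    rw [intervalIntegral.integral_add (hf.integrable_left.mul_continuousOn c')
      (hg.integrable_left.mul_continuousOn c'),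
      intervalIntegral.integral_add (hf.integrable_right.mul_continuousOn c)
      (hg.integrable_right.mul_continuousOn c), hf.integral_eq ψ hψ hp, hg.integral_eq ψ hψ hp,
      neg_add]

/-! ### The equation away from the peaks -/

/-- If `U'' = U` and `V'' = V`, then `H = V + U²U' - aU'³` satisfies `H'' = H + E' + R`, where `E` and
`R` are the two nonlocal terms; this is that identity tested against `exp (kx)` on `[l, r]`. -/
theorem integral_segment (a b : ℝ) (k : ℂ) {U U' V V' : ℝ → ℝ}
    (hU : ∀ x, HasDerivAt U (U' x) x) (hU' : ∀ x, HasDerivAt U' (U x) x)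
    (hV : ∀ x, HasDerivAt V (V' x) x) (hV' : ∀ x, HasDerivAt V' (V x) x) (l r : ℝ) :
    ∫ x in l..r, (((V x + (U x ^ 2 * U' x - a * U' x ^ 3) : ℝ) : ℂ) * (1 - k ^ 2)
        - k * ((b / 3 * U x ^ 3 + (6 - 6 * a - b) / 2 * (U x * U' x ^ 2) : ℝ) : ℂ)
        + (((2 * a + b - 2) / 2 * U' x ^ 3 : ℝ) : ℂ)) * Complex.exp (k * x)
      = (-(k * ((V r + (U r ^ 2 * U' r - a * U' r ^ 3) : ℝ) : ℂ))
          + ((V' r + (1 - b / 3) * U r ^ 3 + (b / 2 - 1) * (U r * U' r ^ 2) : ℝ) : ℂ))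
          * Complex.exp (k * r)
        - (-(k * ((V l + (U l ^ 2 * U' l - a * U' l ^ 3) : ℝ) : ℂ))
          + ((V' l + (1 - b / 3) * U l ^ 3 + (b / 2 - 1) * (U l * U' l ^ 2) : ℝ) : ℂ))
          * Complex.exp (k * l) := by
  have cU : Continuous U := continuous_iff_continuousAt.2 fun x => (hU x).continuousAt
  have cU' : Continuous U' := continuous_iff_continuousAt.2 fun x => (hU' x).continuousAt
  have cV : Continuous V := continuous_iff_continuousAt.2 fun x => (hV x).continuousAt
  -- The antiderivative is `(H' - E - kH) exp (kx)`. In `H' - E` the terms with `a` cancel, and its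
  -- derivative is `H + R`.
  refine intervalIntegral.integral_eq_sub_of_hasDerivAt (f := fun x : ℝ =>
      (-(k * ((V x + (U x ^ 2 * U' x - a * U' x ^ 3) : ℝ) : ℂ))
          + ((V' x + (1 - b / 3) * U x ^ 3 + (b / 2 - 1) * (U x * U' x ^ 2) : ℝ) : ℂ))
          * Complex.exp (k * x)) (fun x _ => ?_)
    (Continuous.intervalIntegrable (by fun_prop) _ _)
  have hA : HasDerivAt (fun x => V x + (U x ^ 2 * U' x - a * U' x ^ 3))
      (V' x + (2 * (U x * U' x ^ 2) + U x ^ 3 - 3 * a * (U x * U' x ^ 2))) x :=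
    ((hV x).add ((((hU x).pow 2).mul (hU' x)).sub (((hU' x).pow 3).const_mul a))).congr_deriv
      (by simp; ring)
  have hB : HasDerivAt (fun x => V' x + (1 - b / 3) * U x ^ 3 + (b / 2 - 1) * (U x * U' x ^ 2))
      (V x + (U x ^ 2 * U' x + (b / 2 - 1) * U' x ^ 3)) x :=
    (((hV' x).add (((hU x).pow 3).const_mul _)).add
      (((hU x).mul ((hU' x).pow 2)).const_mul _)).congr_deriv (by simp; ring)
  have hexp : HasDerivAt (fun x : ℝ => Complex.exp (k * x)) (Complex.exp (k * x) * (k * 1)) x :=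
    ((Complex.ofRealCLM.hasDerivAt (x := x)).const_mul k).cexp
  exact (((hA.ofReal_comp.const_mul k).neg.add hB.ofReal_comp).mul hexp).congr_deriv
    (by simp only [Pi.add_apply, Pi.neg_apply]; push_cast; ring)

theorem hasDerivAt_cosh_sub (q x : ℝ) :
    HasDerivAt (fun x => cosh (x - q)) (sinh (x - q)) x := by
  simpa using ((hasDerivAt_id x).sub_const q).cosh

theorem hasDerivAt_sinh_sub (q x : ℝ) :
    HasDerivAt (fun x => sinh (x - q)) (cosh (x - q)) x := by
  simpa using ((hasDerivAt_id x).sub_const q).sinh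

/-- `(1 - ∂ₓ²) g` is `2 sinh π` times a Dirac mass at the peak. The computation is
`integral_segment` with `U = 0` and `V` the peakon, over the period that starts at `q`. -/
theorem coeff_peakon (q : ℝ) (n : ℤ) :
    coeff (fun x => peakon (x - q)) n
      = (sinh π / π : ℝ) * Complex.exp (-(n * Complex.I) * q) / (1 + (n : ℂ) ^ 2) := by
  set k : ℂ := -(n * Complex.I) with hk
  have hk2 : 1 - k ^ 2 = 1 + (n : ℂ) ^ 2 := by
    rw [hk, neg_sq, mul_pow, Complex.I_sq]; ring
  have hper : Function.Periodic (fun x : ℝ => Complex.exp (k * x)) (2 * π) := fun x => by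
    change Complex.exp (k * ((x + 2 * π : ℝ) : ℂ)) = Complex.exp (k * x)
    rw [Complex.ofReal_add, mul_add, Complex.exp_add, hk, cexp_int_period, mul_one]
  have hG : Function.Periodic
      (fun x : ℝ => ((peakon (x - q) : ℝ) : ℂ) * Complex.exp (k * x)) (2 * π) := fun x => by
    have h1 := hper x
    have h2 := periodic_comp_sub peakon_periodic q x
    simp only at h1 h2 ⊢
    rw [h1, h2]
  have hi : ∫ x in (0 : ℝ)..(2 * π), ((peakon (x - q) : ℝ) : ℂ) * Complex.exp (k * x)
      = ∫ x in q..(q + 2 * π), ((cosh (x - (q + π)) : ℝ) : ℂ) * Complex.exp (k * x) := by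
    rw [integral_period_eq hG q]
    refine intervalIntegral.integral_congr_Ioo_of_le (by linarith [pi_pos]) fun x hx => ?_
    rw [peakon, centred_of_pos (by linarith [hx.1]) (by linarith [hx.2]), sub_sub]
  have hs := integral_segment 0 0 k (U := fun _ => 0) (U' := fun _ => 0)
    (fun x => hasDerivAt_const x 0) (fun x => hasDerivAt_const x 0)
    (hasDerivAt_cosh_sub (q + π)) (hasDerivAt_sinh_sub (q + π)) q (q + 2 * π)
  have e1 : q + 2 * π - (q + π) = π := by ring
  have e2 : q - (q + π) = -π := by ring
  have e3 := hper q
  simp only at e3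
  rw [e1, e2, e3] at hs
  have e4 : ∫ x in q..(q + 2 * π), ((cosh (x - (q + π)) : ℝ) : ℂ) * Complex.exp (k * x)
      = 2 * sinh π * Complex.exp (k * q) / (1 + (n : ℂ) ^ 2) := by
    rw [eq_div_iff (one_add_sq_ne_zero n), ← hk2, ← intervalIntegral.integral_mul_const]
    trans
    · refine Eq.trans (intervalIntegral.integral_congr fun x _ => ?_) hs
      push_cast
      ring
    · simp only [cosh_neg, sinh_neg]
      push_cast
      ring
  rw [coeff_eq, hi, e4]
  push_cast
  have : (π : ℂ) ≠ 0 := by exact_mod_cast pi_ne_zero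
  have := one_add_sq_ne_zero n
  field_simp

/-! ### Superpositions of two peakons -/

/-- `p₁ g(x - q₁) + p₂ g(x - q₂)` for a profile `g`. -/
def superpose (g : ℝ → ℝ) (p₁ p₂ q₁ q₂ x : ℝ) : ℝ := p₁ * g (x - q₁) + p₂ * g (x - q₂)

theorem superpose_periodic {g : ℝ → ℝ} (hg : Function.Periodic g (2 * π)) (p₁ p₂ q₁ q₂ : ℝ) :
    Function.Periodic (superpose g p₁ p₂ q₁ q₂) (2 * π) := fun x => by
  have h1 := periodic_comp_sub hg q₁ x
  have h2 := periodic_comp_sub hg q₂ x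
  simp only at h1 h2
  rw [superpose, superpose, h1, h2]

theorem boundedMeasurable_superpose {g : ℝ → ℝ} (hg : BoundedMeasurable g) (p₁ p₂ q₁ q₂ : ℝ) :
    BoundedMeasurable (superpose g p₁ p₂ q₁ q₂) :=
  ((BoundedMeasurable.const p₁).mul (hg.comp_sub q₁)).add
    ((BoundedMeasurable.const p₂).mul (hg.comp_sub q₂))

theorem isWeakDeriv_superpose (p₁ p₂ q₁ q₂ : ℝ) :
    IsWeakDeriv (superpose peakon p₁ p₂ q₁ q₂) (superpose peakonDeriv p₁ p₂ q₁ q₂) :=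
  ((isWeakDeriv_peakon q₁).const_mul p₁).add ((isWeakDeriv_peakon q₂).const_mul p₂)

theorem coeff_superpose (p₁ p₂ q₁ q₂ : ℝ) (n : ℤ) :
    coeff (superpose peakon p₁ p₂ q₁ q₂) n
      = (sinh π / π : ℝ) * (p₁ * Complex.exp (-(n * Complex.I) * q₁)
          + p₂ * Complex.exp (-(n * Complex.I) * q₂)) / (1 + (n : ℂ) ^ 2) := by
  have h := coeff_add ((isWeakDeriv_peakon q₁).const_mul p₁).integrable_left
    ((isWeakDeriv_peakon q₂).const_mul p₂).integrable_left n
  rw [coeff_const_mul, coeff_const_mul, coeff_peakon, coeff_peakon] at h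
  rw [show superpose peakon p₁ p₂ q₁ q₂
    = fun x => p₁ * peakon (x - q₁) + p₂ * peakon (x - q₂) from rfl, h]
  ring

/-! ### The system of ordinary differential equations for two peakons -/

/-- The speed of a peak of momentum `p`, the other one having momentum `r` at distance `q`. -/
noncomputable def peakSpeed (a p r q : ℝ) : ℝ :=
  (p * cosh π + r * cosh (π - q)) ^ 2 - a * (3 * r ^ 2 * sinh (π - q) ^ 2 + p ^ 2 * sinh π ^ 2)

/-- The rate of change of the momentum of a peak, up to sign. -/
noncomputable def peakGrowth (b p r q : ℝ) : ℝ :=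
  (b - 2) * (p * cosh π + r * cosh (π - q)) * p * r * sinh (π - q)

/-- The time derivative of a superposition of two moving peakons. -/
noncomputable def superposeVelocity (p₁ p₂ q₁ q₂ dp₁ dp₂ dq₁ dq₂ x : ℝ) : ℝ :=
  superpose peakon dp₁ dp₂ q₁ q₂ x - superpose peakonDeriv (p₁ * dq₁) (p₂ * dq₂) q₁ q₂ x

theorem boundedMeasurable_superposeVelocity (p₁ p₂ q₁ q₂ dp₁ dp₂ dq₁ dq₂ : ℝ) :
    BoundedMeasurable (superposeVelocity p₁ p₂ q₁ q₂ dp₁ dp₂ dq₁ dq₂) :=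
  (boundedMeasurable_superpose boundedMeasurable_peakon _ _ _ _).sub
    (boundedMeasurable_superpose boundedMeasurable_peakonDeriv _ _ _ _)

theorem boundedMeasurable_local {U U' V : ℝ → ℝ} (hU : BoundedMeasurable U)
    (hU' : BoundedMeasurable U') (hV : BoundedMeasurable V) (a : ℝ) :
    BoundedMeasurable fun x => V x + (U x ^ 2 * U' x - a * U' x ^ 3) :=
  hV.add (((hU.pow 2).mul hU').sub ((BoundedMeasurable.const a).mul (hU'.pow 3)))

theorem boundedMeasurable_nonlocal {U U' : ℝ → ℝ} (hU : BoundedMeasurable U)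
    (hU' : BoundedMeasurable U') (c d : ℝ) :
    BoundedMeasurable fun x => c * U x ^ 3 + d * (U x * U' x ^ 2) :=
  ((BoundedMeasurable.const c).mul (hU.pow 3)).add
    ((BoundedMeasurable.const d).mul (hU.mul (hU'.pow 2)))

theorem hasDerivAt_cosh_superpose (p₁ p₂ m₁ m₂ A B x : ℝ) :
    HasDerivAt (fun x => p₁ * cosh (x - A) + p₂ * cosh (x - B)
        - (m₁ * sinh (x - A) + m₂ * sinh (x - B)))
      (p₁ * sinh (x - A) + p₂ * sinh (x - B) - (m₁ * cosh (x - A) + m₂ * cosh (x - B))) x :=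
  (((hasDerivAt_cosh_sub A x).const_mul p₁).add ((hasDerivAt_cosh_sub B x).const_mul p₂)).sub
    (((hasDerivAt_sinh_sub A x).const_mul m₁).add ((hasDerivAt_sinh_sub B x).const_mul m₂))

theorem hasDerivAt_sinh_superpose (p₁ p₂ m₁ m₂ A B x : ℝ) :
    HasDerivAt (fun x => p₁ * sinh (x - A) + p₂ * sinh (x - B)
        - (m₁ * cosh (x - A) + m₂ * cosh (x - B)))
      (p₁ * cosh (x - A) + p₂ * cosh (x - B) - (m₁ * sinh (x - A) + m₂ * sinh (x - B))) x :=
  (((hasDerivAt_sinh_sub A x).const_mul p₁).add ((hasDerivAt_sinh_sub B x).const_mul p₂)).sub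
    (((hasDerivAt_cosh_sub A x).const_mul m₁).add ((hasDerivAt_cosh_sub B x).const_mul m₂))

/-- Two peakons whose momenta and positions obey the peakon system satisfy the equation, frequency
by frequency. -/
theorem coeff_twoPeakon {a b p₁ p₂ q₁ q₂ dp₁ dp₂ dq₁ dq₂ : ℝ} (h12 : q₁ < q₂)
    (h21 : q₂ < q₁ + 2 * π)
    (hq₁ : p₁ * dq₁ = p₁ * peakSpeed a p₁ p₂ (q₂ - q₁))
    (hq₂ : p₂ * dq₂ = p₂ * peakSpeed a p₂ p₁ (q₂ - q₁))
    (hp₁ : dp₁ = -peakGrowth b p₁ p₂ (q₂ - q₁)) (hp₂ : dp₂ = peakGrowth b p₂ p₁ (q₂ - q₁))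
    (n : ℤ) :
    (1 + (n : ℂ) ^ 2) * coeff (fun x => superposeVelocity p₁ p₂ q₁ q₂ dp₁ dp₂ dq₁ dq₂ x
        + (superpose peakon p₁ p₂ q₁ q₂ x ^ 2 * superpose peakonDeriv p₁ p₂ q₁ q₂ x
            - a * superpose peakonDeriv p₁ p₂ q₁ q₂ x ^ 3)) n
      + n * Complex.I * coeff (fun x => b / 3 * superpose peakon p₁ p₂ q₁ q₂ x ^ 3
          + (6 - 6 * a - b) / 2 * (superpose peakon p₁ p₂ q₁ q₂ x *
            superpose peakonDeriv p₁ p₂ q₁ q₂ x ^ 2)) n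
      + coeff (fun x => (2 * a + b - 2) / 2 * superpose peakonDeriv p₁ p₂ q₁ q₂ x ^ 3) n = 0 := by
  have hU := boundedMeasurable_superpose boundedMeasurable_peakon p₁ p₂ q₁ q₂
  have hU' := boundedMeasurable_superpose boundedMeasurable_peakonDeriv p₁ p₂ q₁ q₂
  have hV := boundedMeasurable_superposeVelocity p₁ p₂ q₁ q₂ dp₁ dp₂ dq₁ dq₂
  have pU := superpose_periodic peakon_periodic p₁ p₂ q₁ q₂
  have pU' := superpose_periodic peakonDeriv_periodic p₁ p₂ q₁ q₂
  have pV : Function.Periodic (superposeVelocity p₁ p₂ q₁ q₂ dp₁ dp₂ dq₁ dq₂) (2 * π) := fun x => by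
    rw [superposeVelocity, superposeVelocity, superpose_periodic peakon_periodic,
      superpose_periodic peakonDeriv_periodic]
  have eU : ∀ x, superpose peakon p₁ p₂ q₁ q₂ x
      = p₁ * cosh (centred (x - q₁)) + p₂ * cosh (centred (x - q₂)) := fun x => rfl
  have eU' : ∀ x, superpose peakonDeriv p₁ p₂ q₁ q₂ x
      = p₁ * sinh (centred (x - q₁)) + p₂ * sinh (centred (x - q₂)) := fun x => rfl
  have eV : ∀ x, superposeVelocity p₁ p₂ q₁ q₂ dp₁ dp₂ dq₁ dq₂ x
      = dp₁ * cosh (centred (x - q₁)) + dp₂ * cosh (centred (x - q₂))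
        - (p₁ * dq₁ * sinh (centred (x - q₁)) + p₂ * dq₂ * sinh (centred (x - q₂))) :=
    fun x => rfl
  generalize superpose peakon p₁ p₂ q₁ q₂ = U at *
  generalize superpose peakonDeriv p₁ p₂ q₁ q₂ = U' at *
  generalize superposeVelocity p₁ p₂ q₁ q₂ dp₁ dp₂ dq₁ dq₂ = V at *
  set k : ℂ := -(n * Complex.I) with hk
  have hk2 : 1 + (n : ℂ) ^ 2 = 1 - k ^ 2 := by
    rw [hk, neg_sq, mul_pow, Complex.I_sq]; ring
  have hper : ∀ x : ℝ, Complex.exp (k * ((x + 2 * π : ℝ) : ℂ)) = Complex.exp (k * x) := fun x => by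
    rw [Complex.ofReal_add, mul_add, Complex.exp_add, hk, cexp_int_period, mul_one]
  let G : ℝ → ℂ := fun x => (((V x + (U x ^ 2 * U' x - a * U' x ^ 3) : ℝ) : ℂ) * (1 - k ^ 2)
        - k * ((b / 3 * U x ^ 3 + (6 - 6 * a - b) / 2 * (U x * U' x ^ 2) : ℝ) : ℂ)
        + (((2 * a + b - 2) / 2 * U' x ^ 3 : ℝ) : ℂ)) * Complex.exp (k * x)
  have hGint : ∀ l r, IntervalIntegrable G volume l r := fun l r => by
    have c := continuous_cexp_mul k
    have i1 := ((boundedMeasurable_local hU hU' hV a).intervalIntegrable_mul c l r).const_mul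
      (1 - k ^ 2)
    have i2 := ((boundedMeasurable_nonlocal hU hU' (b / 3)
      ((6 - 6 * a - b) / 2)).intervalIntegrable_mul c l r).const_mul k
    have i3 := ((BoundedMeasurable.const ((2 * a + b - 2) / 2)).mul
      (hU'.pow 3)).intervalIntegrable_mul c l r
    refine ((i1.sub i2).add i3).congr fun x _ => ?_
    simp only [G]
    ring
  have hG : ∫ x in (0 : ℝ)..(2 * π), G x = 0 := by
    -- The period is moved to start at a peak and cut at the other one, so that the solution is
    -- smooth on each piece.
    rw [integral_period_eq (q := q₁) (fun x => by simp only [G, hper, pU x, pU' x, pV x]),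
      ← intervalIntegral.integral_add_adjacent_intervals (hGint q₁ q₂) (hGint q₂ (q₁ + 2 * π))]
    -- The shifts `± π` record the branch of `centred`: on the first piece `x` lies to the right of
    -- `q₁` and to the left of `q₂`, on the second to the right of both. Taking `m₁ = m₂ = 0` gives
    -- the profile itself.
    have s1 := integral_segment a b k
      (fun x => by simpa using hasDerivAt_cosh_superpose p₁ p₂ 0 0 (q₁ + π) (q₂ - π) x)
      (fun x => by simpa using hasDerivAt_sinh_superpose p₁ p₂ 0 0 (q₁ + π) (q₂ - π) x)
      (hasDerivAt_cosh_superpose dp₁ dp₂ (p₁ * dq₁) (p₂ * dq₂) (q₁ + π) (q₂ - π))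
      (hasDerivAt_sinh_superpose dp₁ dp₂ (p₁ * dq₁) (p₂ * dq₂) (q₁ + π) (q₂ - π)) q₁ q₂
    have s2 := integral_segment a b k
      (fun x => by simpa using hasDerivAt_cosh_superpose p₁ p₂ 0 0 (q₁ + π) (q₂ + π) x)
      (fun x => by simpa using hasDerivAt_sinh_superpose p₁ p₂ 0 0 (q₁ + π) (q₂ + π) x)
      (hasDerivAt_cosh_superpose dp₁ dp₂ (p₁ * dq₁) (p₂ * dq₂) (q₁ + π) (q₂ + π))
      (hasDerivAt_sinh_superpose dp₁ dp₂ (p₁ * dq₁) (p₂ * dq₂) (q₁ + π) (q₂ + π)) q₂ (q₁ + 2 * π)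
    rw [hper] at s2
    have t1 := (intervalIntegral.integral_congr_Ioo_of_le (μ := volume) (f := G) h12.le
      fun x hx => by
        simp only [G, eU, eU', eV]
        rw [centred_of_pos (x := x - q₁) (by linarith [hx.1]) (by linarith [hx.2]),
          centred_of_neg (x := x - q₂) (by linarith [hx.1]) (by linarith [hx.2]),
          sub_sub x q₁ π, show x - q₂ + π = x - (q₂ - π) by ring]).trans s1
    have t2 := (intervalIntegral.integral_congr_Ioo_of_le (μ := volume) (f := G) h21.le
      fun x hx => by
        simp only [G, eU, eU', eV]
        rw [centred_of_pos (x := x - q₁) (by linarith [hx.1]) (by linarith [hx.2]),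
          centred_of_pos (x := x - q₂) (by linarith [hx.1]) (by linarith [hx.2]),
          sub_sub x q₁ π, sub_sub x q₂ π]).trans s2
    rw [t1, t2]
    have e1 : q₁ - (q₁ + π) = -π := by ring
    have e2 : q₁ - (q₂ - π) = π - (q₂ - q₁) := by ring
    have e3 : q₂ - (q₁ + π) = -(π - (q₂ - q₁)) := by ring
    have e4 : q₂ - (q₂ - π) = π := by ring
    have e5 : q₂ - (q₂ + π) = -π := by ring
    have e6 : q₁ + 2 * π - (q₁ + π) = π := by ring
    have e7 : q₁ + 2 * π - (q₂ + π) = π - (q₂ - q₁) := by ring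
    rw [peakSpeed] at hq₁ hq₂
    rw [peakGrowth] at hp₁ hp₂
    rw [e1, e2, e3, e4, e5, e6, e7]
    simp only [cosh_neg, sinh_neg]
    generalize cosh (π - (q₂ - q₁)) = c at *
    generalize sinh (π - (q₂ - q₁)) = σ at *
    generalize cosh π = C at *
    generalize sinh π = S at *
    generalize Complex.exp (k * q₁) = E₁
    generalize Complex.exp (k * q₂) = E₂
    subst hp₁ hp₂
    have hq₁' := congrArg (fun x : ℝ => (x : ℂ)) hq₁
    have hq₂' := congrArg (fun x : ℝ => (x : ℂ)) hq₂
    push_cast at hq₁' hq₂' ⊢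
    -- At each peak the part with factor `k` is the jump of `H`, equal to `2 sinh π` times the
    -- defect in the speed law. The part without `k` is the jump of `H' - E`, which the substituted
    -- momentum laws cancel; their signs are opposite because each peak sees the other from the
    -- opposite side.
    linear_combination (2 * k * S * E₁) * hq₁' + (2 * k * S * E₂) * hq₂'
  have hsplit : ∫ x in (0 : ℝ)..(2 * π), G x = (1 - k ^ 2) *
      (∫ x in (0 : ℝ)..(2 * π), ((V x + (U x ^ 2 * U' x - a * U' x ^ 3) : ℝ) : ℂ)
        * Complex.exp (k * x))
      - k * (∫ x in (0 : ℝ)..(2 * π), ((b / 3 * U x ^ 3 + (6 - 6 * a - b) / 2 *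
        (U x * U' x ^ 2) : ℝ) : ℂ) * Complex.exp (k * x))
      + ∫ x in (0 : ℝ)..(2 * π), (((2 * a + b - 2) / 2 * U' x ^ 3 : ℝ) : ℂ)
        * Complex.exp (k * x) := by
    have c := continuous_cexp_mul k
    have i1 := ((boundedMeasurable_local hU hU' hV a).intervalIntegrable_mul c
      0 (2 * π)).const_mul (1 - k ^ 2)
    have i2 := ((boundedMeasurable_nonlocal hU hU' (b / 3)
      ((6 - 6 * a - b) / 2)).intervalIntegrable_mul c 0 (2 * π)).const_mul k
    have i3 := ((BoundedMeasurable.const ((2 * a + b - 2) / 2)).mul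
      (hU'.pow 3)).intervalIntegrable_mul c 0 (2 * π)
    rw [← intervalIntegral.integral_const_mul, ← intervalIntegral.integral_const_mul,
      ← intervalIntegral.integral_sub i1 i2, ← intervalIntegral.integral_add (i1.sub i2) i3]
    refine intervalIntegral.integral_congr fun x _ => ?_
    simp only [G]
    ring
  rw [hsplit] at hG
  rw [coeff_eq, coeff_eq, coeff_eq, ← hk, hk2, show (n : ℂ) * Complex.I = -k by rw [hk, neg_neg]]
  linear_combination (1 / (2 * π) : ℂ) * hG

/-! ### Integration by parts in time -/

section Test

variable {T : ℝ} {φ : ℝ → ℝ → ℝ}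

theorem IsTest.hasFDerivAt (hφ : IsTest T φ) (z : ℝ × ℝ) :
    HasFDerivAt (Function.uncurry φ) (fderiv ℝ (Function.uncurry φ) z) z :=
  (hφ.smooth.differentiable (by simp) z).hasFDerivAt

theorem IsTest.contDiff_space (hφ : IsTest T φ) (t : ℝ) : ContDiff ℝ ∞ (φ t) :=
  hφ.smooth.comp (contDiff_const.prodMk contDiff_id)

theorem IsTest.deriv_time (hφ : IsTest T φ) (t x : ℝ) :
    deriv (fun τ => φ τ x) t = fderiv ℝ (Function.uncurry φ) (t, x) (1, 0) :=
  ((hφ.hasFDerivAt (t, x)).comp_hasDerivAt (f := fun τ => (τ, x)) t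
    ((hasDerivAt_id t).prodMk (hasDerivAt_const t x))).deriv

theorem IsTest.deriv_space (hφ : IsTest T φ) (t x : ℝ) :
    deriv (φ t) x = fderiv ℝ (Function.uncurry φ) (t, x) (0, 1) :=
  ((hφ.hasFDerivAt (t, x)).comp_hasDerivAt (f := fun y => (t, y)) x
    ((hasDerivAt_const x t).prodMk (hasDerivAt_id x))).deriv

theorem IsTest.continuous_deriv_time (hφ : IsTest T φ) :
    Continuous fun z : ℝ × ℝ => deriv (fun τ => φ τ z.2) z.1 := by
  simp only [hφ.deriv_time]
  exact (hφ.smooth.continuous_fderiv (by simp)).clm_apply continuous_const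

theorem IsTest.continuous_deriv_space (hφ : IsTest T φ) :
    Continuous fun z : ℝ × ℝ => deriv (φ z.1) z.2 := by
  simp only [hφ.deriv_space]
  exact (hφ.smooth.continuous_fderiv (by simp)).clm_apply continuous_const

theorem IsTest.periodic_deriv_time (hφ : IsTest T φ) (t : ℝ) :
    Function.Periodic (fun x => deriv (fun τ => φ τ x) t) (2 * π) := fun x => by
  have : (fun τ => φ τ (x + 2 * π)) = fun τ => φ τ x := funext fun τ => hφ.periodic τ x
  simp only [this]

theorem IsTest.periodic_deriv_space (hφ : IsTest T φ) (t : ℝ) :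
    Function.Periodic (deriv (φ t)) (2 * π) := fun x => by
  rw [← deriv_comp_add_const, funext (hφ.periodic t)]

theorem IsTest.hasDerivAt_comp (hφ : IsTest T φ) {q : ℝ → ℝ} {dq t : ℝ} (hq : HasDerivAt q dq t)
    (y : ℝ) : HasDerivAt (fun t => φ t (y + q t))
      (deriv (fun τ => φ τ (y + q t)) t + dq * deriv (φ t) (y + q t)) t := by
  have h := (hφ.hasFDerivAt (t, y + q t)).comp_hasDerivAt t
    ((hasDerivAt_id t).prodMk (hq.const_add y))
  refine h.congr_deriv ?_
  have e : ((1 : ℝ), dq) = (1, 0) + dq • ((0 : ℝ), (1 : ℝ)) := by simp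
  rw [hφ.deriv_time, hφ.deriv_space, e, map_add, map_smul, smul_eq_mul]

theorem IsTest.apply_zero (hφ : IsTest T φ) (x : ℝ) : φ 0 x = 0 := by
  obtain ⟨α, β, h0, -, h⟩ := hφ.support
  exact h 0 (fun h' => absurd h'.1 (not_le.2 h0)) x

theorem IsTest.apply_end (hφ : IsTest T φ) (x : ℝ) : φ T x = 0 := by
  obtain ⟨α, β, -, hT, h⟩ := hφ.support
  exact h T (fun h' => absurd h'.2 (not_le.2 hT)) x

end Test

theorem intervalIntegral_swap_of_continuous {f : ℝ → ℝ → ℝ} (hf : Continuous (Function.uncurry f))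
    {l r l' r' : ℝ} (h : l ≤ r) (h' : l' ≤ r') :
    ∫ t in l..r, ∫ x in l'..r', f t x = ∫ x in l'..r', ∫ t in l..r, f t x := by
  simp only [intervalIntegral.integral_of_le h, intervalIntegral.integral_of_le h']
  refine integral_integral_swap ?_
  rw [Measure.prod_restrict]
  exact (hf.continuousOn.integrableOn_compact (isCompact_Icc.prod isCompact_Icc)).mono_set
    (Set.prod_mono Set.Ioc_subset_Icc_self Set.Ioc_subset_Icc_self)

/-- A peakon with `C¹` momentum and position: functions continuous on the line, with continuous
functions that are their derivatives on `(0, T)`. -/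
structure MovingPeak (T : ℝ) (p q dp dq : ℝ → ℝ) : Prop where
  continuous_p : Continuous p
  continuous_q : Continuous q
  continuous_dp : Continuous dp
  continuous_dq : Continuous dq
  hasDerivAt_p : ∀ t ∈ Set.Ioo 0 T, HasDerivAt p (dp t) t
  hasDerivAt_q : ∀ t ∈ Set.Ioo 0 T, HasDerivAt q (dq t) t

/-- The integrand of the weak time derivative of a moving peakon. -/
noncomputable def peakFlux (φ : ℝ → ℝ → ℝ) (p q dp dq : ℝ → ℝ) (t : ℝ) : ℝ :=
  ∫ x in (0 : ℝ)..(2 * π), (p t * peakon (x - q t) * deriv (fun τ => φ τ x) t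
    + (dp t * peakon (x - q t) - p t * dq t * peakonDeriv (x - q t)) * φ t x)

/-- In the frame of the peak, `y = x - q(t)`, the profile no longer depends on time. Moving the
space derivative from the profile to `φ` also removes the discontinuous `peakonDeriv`, so the
integrand becomes jointly continuous. -/
theorem MovingPeak.peakFlux_eq {T : ℝ} {p q dp dq : ℝ → ℝ} {φ : ℝ → ℝ → ℝ} (hφ : IsTest T φ)
    (t : ℝ) :
    peakFlux φ p q dp dq t = ∫ y in (0 : ℝ)..(2 * π), cosh (y - π) *
      (dp t * φ t (y + q t) + p t * (deriv (fun τ => φ τ (y + q t)) t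
        + dq t * deriv (φ t) (y + q t))) := by
  have g := boundedMeasurable_peakon.comp_sub (q t)
  have g' := boundedMeasurable_peakonDeriv.comp_sub (q t)
  have c0 : Continuous (φ t) := (hφ.contDiff_space t).continuous
  have cx : Continuous (deriv (φ t)) := (hφ.contDiff_space t).continuous_deriv (by simp)
  have ct : Continuous fun x => deriv (fun τ => φ τ x) t :=
    hφ.continuous_deriv_time.comp (continuous_const.prodMk continuous_id)
  have i1 := (g.intervalIntegrable_mul_real ct 0 (2 * π)).const_mul (p t)
  have i2 := (g.intervalIntegrable_mul_real c0 0 (2 * π)).const_mul (dp t)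
  have i3 := (g'.intervalIntegrable_mul_real c0 0 (2 * π)).const_mul (p t * dq t)
  have e1 : peakFlux φ p q dp dq t
      = p t * (∫ x in (0 : ℝ)..(2 * π), peakon (x - q t) * deriv (fun τ => φ τ x) t)
        + dp t * (∫ x in (0 : ℝ)..(2 * π), peakon (x - q t) * φ t x)
        - p t * dq t * ∫ x in (0 : ℝ)..(2 * π), peakonDeriv (x - q t) * φ t x := by
    simp only [← intervalIntegral.integral_const_mul]
    rw [← intervalIntegral.integral_add i1 i2, ← intervalIntegral.integral_sub (i1.add i2) i3]
    refine intervalIntegral.integral_congr fun x _ => ?_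
    ring
  have hw := (isWeakDeriv_peakon (q t)).integral_eq _ (hφ.contDiff_space t) (hφ.periodic t)
  have hw' : ∫ x in (0 : ℝ)..(2 * π), peakonDeriv (x - q t) * φ t x
      = -∫ x in (0 : ℝ)..(2 * π), peakon (x - q t) * deriv (φ t) x := by rw [hw, neg_neg]
  have h0 := boundedMeasurable_peakon
  have cs : Continuous fun y : ℝ => y + q t := by fun_prop
  have j1 := (h0.intervalIntegrable_mul_real (ct.comp cs) 0 (2 * π)).const_mul (p t)
  have j2 := (h0.intervalIntegrable_mul_real (c0.comp cs) 0 (2 * π)).const_mul (dp t)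
  have j3 := (h0.intervalIntegrable_mul_real (cx.comp cs) 0 (2 * π)).const_mul (p t * dq t)
  rw [e1, hw', integral_comp_sub_mul peakon_periodic (hφ.periodic_deriv_time t),
    integral_comp_sub_mul peakon_periodic (hφ.periodic t),
    integral_comp_sub_mul peakon_periodic (hφ.periodic_deriv_space t), mul_neg, sub_neg_eq_add]
  simp only [← intervalIntegral.integral_const_mul]
  refine (congrArg₂ (· + ·) (intervalIntegral.integral_add j1 j2).symm rfl).trans ?_
  refine (intervalIntegral.integral_add (j1.add j2) j3).symm.trans ?_
  refine intervalIntegral.integral_congr_Ioo_of_le Real.two_pi_pos.le fun y hy => ?_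
  simp only [Function.comp_apply]
  rw [peakon, centred_of_pos hy.1 hy.2]
  ring

theorem MovingPeak.continuous_integrand {T : ℝ} {p q dp dq : ℝ → ℝ} {φ : ℝ → ℝ → ℝ}
    (h : MovingPeak T p q dp dq) (hφ : IsTest T φ) :
    Continuous (Function.uncurry fun t y : ℝ => cosh (y - π) *
      (dp t * φ t (y + q t) + p t * (deriv (fun τ => φ τ (y + q t)) t
        + dq t * deriv (φ t) (y + q t)))) := by
  have hp := h.continuous_p
  have hq := h.continuous_q
  have hdp := h.continuous_dp
  have hdq := h.continuous_dq
  have cs : Continuous fun z : ℝ × ℝ => (z.1, z.2 + q z.1) := by fun_prop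
  have c0 : Continuous fun z : ℝ × ℝ => φ z.1 (z.2 + q z.1) := hφ.smooth.continuous.comp cs
  have ct : Continuous fun z : ℝ × ℝ => deriv (fun τ => φ τ (z.2 + q z.1)) z.1 :=
    hφ.continuous_deriv_time.comp cs
  have cx : Continuous fun z : ℝ × ℝ => deriv (φ z.1) (z.2 + q z.1) :=
    hφ.continuous_deriv_space.comp cs
  change Continuous fun z : ℝ × ℝ => cosh (z.2 - π) *
      (dp z.1 * φ z.1 (z.2 + q z.1) + p z.1 * (deriv (fun τ => φ τ (z.2 + q z.1)) z.1
        + dq z.1 * deriv (φ z.1) (z.2 + q z.1)))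
  exact (continuous_cosh.comp (continuous_snd.sub continuous_const)).mul
    (((hdp.comp continuous_fst).mul c0).add
      ((hp.comp continuous_fst).mul (ct.add ((hdq.comp continuous_fst).mul cx))))

theorem MovingPeak.continuous_peakFlux {T : ℝ} {p q dp dq : ℝ → ℝ} {φ : ℝ → ℝ → ℝ}
    (h : MovingPeak T p q dp dq) (hφ : IsTest T φ) : Continuous (peakFlux φ p q dp dq) := by
  rw [funext fun t => MovingPeak.peakFlux_eq (p := p) (q := q) (dp := dp) (dq := dq) hφ t]
  exact intervalIntegral.continuous_parametric_intervalIntegral_of_continuous'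
    (h.continuous_integrand hφ) _ _

/-- For fixed `y` in the moving frame the integrand is the time derivative of `cosh (y - π) p(t)
φ(t, y + q(t))`, and `φ` vanishes at both ends of `[0, T]`. -/
theorem MovingPeak.integral_peakFlux {T : ℝ} (hT : 0 < T) {p q dp dq : ℝ → ℝ} {φ : ℝ → ℝ → ℝ}
    (h : MovingPeak T p q dp dq) (hφ : IsTest T φ) :
    ∫ t in (0 : ℝ)..T, peakFlux φ p q dp dq t = 0 := by
  have hc := h.continuous_integrand hφ
  simp only [MovingPeak.peakFlux_eq hφ]
  rw [intervalIntegral_swap_of_continuous hc hT.le Real.two_pi_pos.le]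
  have hz : ∀ y, ∫ t in (0 : ℝ)..T, cosh (y - π) *
      (dp t * φ t (y + q t) + p t * (deriv (fun τ => φ τ (y + q t)) t
        + dq t * deriv (φ t) (y + q t))) = 0 := fun y => by
    have hp := h.continuous_p
    have hq := h.continuous_q
    have c0 : Continuous fun t => φ t (y + q t) :=
      hφ.smooth.continuous.comp (continuous_id.prodMk (by fun_prop : Continuous fun t => y + q t))
    have := intervalIntegral.integral_eq_sub_of_hasDerivAt_of_le hT.le
      (f := fun t => cosh (y - π) * (p t * φ t (y + q t)))
      (continuous_const.mul (hp.mul c0)).continuousOn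
      (fun t ht => ((h.hasDerivAt_p t ht).mul
        (hφ.hasDerivAt_comp (h.hasDerivAt_q t ht) y)).const_mul (cosh (y - π)))
      ((hc.comp (continuous_id.prodMk continuous_const)).intervalIntegrable 0 T)
    rw [this, hφ.apply_zero, hφ.apply_end]
    simp
  simp [hz]

/-! ### Superpositions of peakons in `H^s`, `s < 3/2` -/

/-- The terms decay like `|n| ^ (-(4 - 2s))`, and `4 - 2s > 1` is exactly `s < 3/2`. As above, `n =
0` gets its own summand. -/
theorem summable_one_add_sq_rpow {s : ℝ} (hs : s < 3 / 2) :
    Summable fun n : ℤ => (1 + (n : ℝ) ^ 2) ^ (s - 2) := by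
  refine Summable.of_nonneg_of_le (fun n => by positivity) (fun n => ?_)
    ((Real.summable_abs_int_rpow (b := 4 - 2 * s) (by linarith)).add
      (summable_of_ne_finset_zero (s := {0}) (f := fun n : ℤ => if n = 0 then (1 : ℝ) else 0)
        (by intro n hn; simpa using hn)))
  by_cases hn : n = 0
  · simp only [hn, if_true]
    simp only [Int.cast_zero, ne_eq, OfNat.ofNat_ne_zero, not_false_eq_true, zero_pow, add_zero,
      Real.one_rpow, le_add_iff_nonneg_left]
    positivity
  · simp only [hn, if_false, add_zero]
    have h0 : (0 : ℝ) < |(n : ℝ)| := by positivity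
    have e : |(n : ℝ)| ^ (-(4 - 2 * s)) = ((n : ℝ) ^ 2) ^ (s - 2) := by
      rw [← sq_abs, ← Real.rpow_natCast, ← Real.rpow_mul h0.le]
      congr 1
      push_cast
      ring
    rw [e]
    exact Real.rpow_le_rpow_of_nonpos (by positivity) (by linarith) (by linarith)

theorem rpow_mul_sq_le {s C : ℝ} {n : ℤ} {c : ℂ} (h : ‖c‖ ≤ C / (1 + (n : ℝ) ^ 2)) :
    (1 + (n : ℝ) ^ 2) ^ s * ‖c‖ ^ 2 ≤ C ^ 2 * (1 + (n : ℝ) ^ 2) ^ (s - 2) := by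
  have h0 : (0 : ℝ) < 1 + (n : ℝ) ^ 2 := by positivity
  have e : (1 + (n : ℝ) ^ 2) ^ (s - 2) = (1 + (n : ℝ) ^ 2) ^ s / (1 + (n : ℝ) ^ 2) ^ 2 := by
    rw [Real.rpow_sub h0]
    norm_num
  calc (1 + (n : ℝ) ^ 2) ^ s * ‖c‖ ^ 2
      ≤ (1 + (n : ℝ) ^ 2) ^ s * (C / (1 + (n : ℝ) ^ 2)) ^ 2 := by gcongr
    _ = C ^ 2 * (1 + (n : ℝ) ^ 2) ^ (s - 2) := by rw [e, div_pow]; ring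

theorem norm_coeff_superpose_le (p₁ p₂ q₁ q₂ : ℝ) (n : ℤ) :
    ‖coeff (superpose peakon p₁ p₂ q₁ q₂) n‖
      ≤ sinh π / π * (|p₁| + |p₂|) / (1 + (n : ℝ) ^ 2) := by
  have hE : ∀ q : ℝ, ‖Complex.exp (-(n * Complex.I) * q)‖ = 1 := fun q => by
    have := norm_cexp_int (-n) q
    rw [← this]
    congr 2
    push_cast
    ring
  have hS : 0 ≤ sinh π / π := div_nonneg (sinh_nonneg_iff.2 pi_pos.le) pi_pos.le
  rw [coeff_superpose, norm_div, norm_one_add_sq, norm_mul, Complex.norm_real, Real.norm_of_nonneg hS]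
  gcongr
  refine (norm_add_le _ _).trans ?_
  rw [norm_mul, norm_mul, hE, hE, Complex.norm_real, Complex.norm_real, mul_one, mul_one]
  rfl

theorem integrable_superpose (p₁ p₂ q₁ q₂ : ℝ) :
    IntervalIntegrable (superpose peakon p₁ p₂ q₁ q₂) volume 0 (2 * π) :=
  (isWeakDeriv_superpose p₁ p₂ q₁ q₂).integrable_left

theorem memHs_superpose {s : ℝ} (hs : s < 3 / 2) (p₁ p₂ q₁ q₂ : ℝ) :
    MemHs s (superpose peakon p₁ p₂ q₁ q₂) where
  periodic := superpose_periodic peakon_periodic _ _ _ _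
  integrable := integrable_superpose _ _ _ _
  summable := Summable.of_nonneg_of_le (fun n => by positivity)
    (fun n => rpow_mul_sq_le (norm_coeff_superpose_le p₁ p₂ q₁ q₂ n))
    ((summable_one_add_sq_rpow hs).mul_left _)

/-- Each Fourier coefficient is continuous in momenta and positions, and the decay bound depends on
the momenta alone, so dominated convergence applies to the series. -/
theorem continuousInHs_superpose {s T : ℝ} (hs : s < 3 / 2) {p₁ p₂ q₁ q₂ : ℝ → ℝ}
    (hp₁ : Continuous p₁) (hp₂ : Continuous p₂) (hq₁ : Continuous q₁) (hq₂ : Continuous q₂) :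
    ContinuousInHs s T fun t => superpose peakon (p₁ t) (p₂ t) (q₁ t) (q₂ t) where
  mem t _ := memHs_superpose hs _ _ _ _
  tendsto t₀ _ := by
    refine Tendsto.mono_left ?_ nhdsWithin_le_nhds
    set u : ℝ → ℝ → ℝ := fun t => superpose peakon (p₁ t) (p₂ t) (q₁ t) (q₂ t) with hu
    have hc : ∀ n t, coeff (fun x => u t x - u t₀ x) n = coeff (u t) n - coeff (u t₀) n :=
      fun n t => coeff_sub (integrable_superpose _ _ _ _) (integrable_superpose _ _ _ _) n
    have hcont : ∀ n, Continuous fun t => coeff (u t) n := fun n => by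
      simp only [hu, coeff_superpose]
      fun_prop
    set M : ℝ := |p₁ t₀| + |p₂ t₀| with hM
    have hev : ∀ᶠ t in 𝓝 t₀, |p₁ t| + |p₂ t| < M + 1 :=
      (hp₁.abs.add hp₂.abs).continuousAt.eventually_lt continuousAt_const (by simp [hM])
    have hsum := tendsto_tsum_of_dominated_convergence (𝓕 := 𝓝 t₀)
      (f := fun t (n : ℤ) => (1 + (n : ℝ) ^ 2) ^ s * ‖coeff (fun x => u t x - u t₀ x) n‖ ^ 2)
      (g := fun _ => 0)
      -- `M + 1` bounds the momenta near `t₀`, and `M` is their size at `t₀`.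
      (bound := fun n : ℤ => (sinh π / π * (M + 1) + sinh π / π * M) ^ 2
        * (1 + (n : ℝ) ^ 2) ^ (s - 2))
      ((summable_one_add_sq_rpow hs).mul_left _)
      (fun n => by
        have h : Continuous fun t =>
            (1 + (n : ℝ) ^ 2) ^ s * ‖coeff (fun x => u t x - u t₀ x) n‖ ^ 2 := by
          simp only [hc]
          exact continuous_const.mul (((hcont n).sub continuous_const).norm.pow 2)
        have h' := h.tendsto t₀
        rwa [hc n t₀, sub_self, norm_zero, zero_pow two_ne_zero, mul_zero] at h')
      (by
        filter_upwards [hev] with t ht n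
        rw [Real.norm_of_nonneg (by positivity)]
        refine rpow_mul_sq_le ?_
        rw [hc, add_div]
        refine (norm_sub_le _ _).trans (add_le_add ?_ (norm_coeff_superpose_le _ _ _ _ n))
        refine (norm_coeff_superpose_le _ _ _ _ n).trans ?_
        have hS : 0 ≤ sinh π / π := div_nonneg (sinh_nonneg_iff.2 pi_pos.le) pi_pos.le
        gcongr)
    have := (Real.continuous_sqrt.tendsto _).comp hsum
    simpa [hsNorm, Function.comp_def] using this

theorem memLp_superpose {T : ℝ} {g : ℝ → ℝ} (hg : BoundedMeasurable g) {p₁ p₂ q₁ q₂ : ℝ → ℝ}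
    (hp₁ : Continuous p₁) (hp₂ : Continuous p₂) (hq₁ : Continuous q₁) (hq₂ : Continuous q₂)
    (p : ENNReal) :
    MemLp (Function.uncurry fun t => superpose g (p₁ t) (p₂ t) (q₁ t) (q₂ t)) p
      (volume.restrict (Set.Ioo 0 T ×ˢ Set.Ioo 0 (2 * π))) := by
  have : IsFiniteMeasure (volume.restrict (Set.Ioo 0 T ×ˢ Set.Ioo 0 (2 * π))) :=
    ⟨by
      rw [Measure.restrict_apply_univ]
      exact ((Metric.isBounded_Ioo 0 T).prod (Metric.isBounded_Ioo 0 (2 * π))).measure_lt_top⟩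
  obtain ⟨C, hC⟩ := hg.bounded
  obtain ⟨M, hM⟩ := isCompact_Icc.exists_bound_of_continuousOn (s := Set.Icc 0 T)
    ((hp₁.abs.add hp₂.abs).continuousOn)
  refine MemLp.of_bound (C := M * C) ?_ ?_
  · have m : Measurable g := hg.measurable
    have : Measurable fun z : ℝ × ℝ =>
        p₁ z.1 * g (z.2 - q₁ z.1) + p₂ z.1 * g (z.2 - q₂ z.1) := by
      have := hp₁.measurable
      have := hp₂.measurable
      have := hq₁.measurable
      have := hq₂.measurable
      fun_prop
    exact this.aestronglyMeasurable
  · filter_upwards [ae_restrict_mem (measurableSet_Ioo.prod measurableSet_Ioo)] with z hz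
    have h := (le_abs_self _).trans (hM z.1 (Set.Ioo_subset_Icc_self hz.1))
    have hC0 : 0 ≤ C := (abs_nonneg _).trans (hC 0)
    calc |p₁ z.1 * g (z.2 - q₁ z.1) + p₂ z.1 * g (z.2 - q₂ z.1)|
        ≤ |p₁ z.1| * C + |p₂ z.1| * C := by
          refine (abs_add_le _ _).trans ?_
          rw [abs_mul, abs_mul]
          gcongr <;> exact hC _
      _ = (|p₁ z.1| + |p₂ z.1|) * C := by ring
      _ ≤ M * C := by exact mul_le_mul_of_nonneg_right h hC0

/-! ### Two-peakon solutions -/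

/-- Two moving peaks that are distinct on `(0, T)` and obey the peakon system there. -/
structure TwoPeakonFlow (a b T : ℝ) (p₁ p₂ q₁ q₂ dp₁ dp₂ dq₁ dq₂ : ℝ → ℝ) : Prop where
  peak₁ : MovingPeak T p₁ q₁ dp₁ dq₁
  peak₂ : MovingPeak T p₂ q₂ dp₂ dq₂
  lt : ∀ t ∈ Set.Ioo 0 T, q₁ t < q₂ t
  lt_add : ∀ t ∈ Set.Ioo 0 T, q₂ t < q₁ t + 2 * π
  speed₁ : ∀ t ∈ Set.Ioo 0 T, p₁ t * dq₁ t = p₁ t * peakSpeed a (p₁ t) (p₂ t) (q₂ t - q₁ t)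
  speed₂ : ∀ t ∈ Set.Ioo 0 T, p₂ t * dq₂ t = p₂ t * peakSpeed a (p₂ t) (p₁ t) (q₂ t - q₁ t)
  growth₁ : ∀ t ∈ Set.Ioo 0 T, dp₁ t = -peakGrowth b (p₁ t) (p₂ t) (q₂ t - q₁ t)
  growth₂ : ∀ t ∈ Set.Ioo 0 T, dp₂ t = peakGrowth b (p₂ t) (p₁ t) (q₂ t - q₁ t)

/-- Add and subtract the velocity times `φ`. At each time the equation with the classical velocity
holds weakly in space, by `coeff_twoPeakon`; the rest is minus the two peak fluxes, whose time
integrals vanish. Since only `(0, T)` matters, the peaks may coincide at time `0`. -/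
theorem TwoPeakonFlow.equationHolds {a b T : ℝ} (hT : 0 < T)
    {p₁ p₂ q₁ q₂ dp₁ dp₂ dq₁ dq₂ : ℝ → ℝ} (h : TwoPeakonFlow a b T p₁ p₂ q₁ q₂ dp₁ dp₂ dq₁ dq₂) :
    EquationHolds a b T (fun t => superpose peakon (p₁ t) (p₂ t) (q₁ t) (q₂ t))
      fun t => superpose peakonDeriv (p₁ t) (p₂ t) (q₁ t) (q₂ t) := by
  intro φ hφ
  have c₁ := h.peak₁.continuous_peakFlux hφ
  have c₂ := h.peak₂.continuous_peakFlux hφ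
  trans ∫ t in (0 : ℝ)..T, -(peakFlux φ p₁ q₁ dp₁ dq₁ t + peakFlux φ p₂ q₂ dp₂ dq₂ t)
  · refine intervalIntegral.integral_congr_Ioo_of_le hT.le fun t ht => ?_
    have key := fun n => coeff_twoPeakon (h.lt t ht) (h.lt_add t ht) (h.speed₁ t ht) (h.speed₂ t ht)
      (h.growth₁ t ht) (h.growth₂ t ht) n
    have hU := boundedMeasurable_superpose boundedMeasurable_peakon (p₁ t) (p₂ t) (q₁ t) (q₂ t)
    have hU' := boundedMeasurable_superpose boundedMeasurable_peakonDeriv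
      (p₁ t) (p₂ t) (q₁ t) (q₂ t)
    have hV := boundedMeasurable_superposeVelocity (p₁ t) (p₂ t) (q₁ t) (q₂ t)
      (dp₁ t) (dp₂ t) (dq₁ t) (dq₂ t)
    have hH := boundedMeasurable_local hU hU' hV a
    have hE := boundedMeasurable_nonlocal hU hU' (b / 3) ((6 - 6 * a - b) / 2)
    have hR := (BoundedMeasurable.const ((2 * a + b - 2) / 2)).mul (hU'.pow 3)
    have hz := integral_eq_zero_of_coeff hH hE hR (hφ.contDiff_space t) (hφ.periodic t) key
    have k0 : Continuous (φ t) := (hφ.contDiff_space t).continuous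
    have kx : Continuous (deriv (φ t)) := (hφ.contDiff_space t).continuous_deriv (by simp)
    have kt : Continuous fun x => deriv (fun τ => φ τ x) t :=
      hφ.continuous_deriv_time.comp (continuous_const.prodMk continuous_id)
    have i1 := hH.intervalIntegrable_mul_real k0 0 (2 * π)
    have i2 := ((continuous_dinv2 hE).mul kx).intervalIntegrable (μ := volume) 0 (2 * π)
    have i3 := ((continuous_dinv2 hR).mul k0).intervalIntegrable (μ := volume) 0 (2 * π)
    have flux : ∀ p q dp dq : ℝ → ℝ, IntervalIntegrable (fun x =>
        p t * peakon (x - q t) * deriv (fun τ => φ τ x) t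
          + (dp t * peakon (x - q t) - p t * dq t * peakonDeriv (x - q t)) * φ t x)
        volume 0 (2 * π) := fun p q dp dq => by
      have g := boundedMeasurable_peakon.comp_sub (q t)
      have g' := boundedMeasurable_peakonDeriv.comp_sub (q t)
      exact (((BoundedMeasurable.const _).mul g).intervalIntegrable_mul_real kt _ _).add
        ((((BoundedMeasurable.const _).mul g).sub
          ((BoundedMeasurable.const _).mul g')).intervalIntegrable_mul_real k0 _ _)
    have j1 := flux p₁ q₁ dp₁ dq₁
    have j2 := flux p₂ q₂ dp₂ dq₂
    refine Eq.trans ?_ ((congrArg₂ (· + ·) rfl hz).trans (add_zero _))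
    rw [peakFlux, peakFlux, ← intervalIntegral.integral_add j1 j2,
      ← intervalIntegral.integral_neg]
    refine Eq.trans ?_ (congrArg₂ (· + ·) rfl
      ((intervalIntegral.integral_add (i1.sub i2) i3).trans
        (congrArg₂ (· + ·) (intervalIntegral.integral_sub i1 i2) rfl)))
    refine Eq.trans ?_ (intervalIntegral.integral_add (j1.add j2).neg ((i1.sub i2).add i3))
    refine congrArg (fun f : ℝ → ℝ => ∫ x in (0 : ℝ)..(2 * π), f x) (funext fun x => ?_)
    simp only [superpose, superposeVelocity, Pi.mul_apply]
    ring
  · rw [intervalIntegral.integral_neg, intervalIntegral.integral_add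
      (c₁.intervalIntegrable _ _) (c₂.intervalIntegrable _ _), h.peak₁.integral_peakFlux hT hφ,
      h.peak₂.integral_peakFlux hT hφ, add_zero, neg_zero]

theorem TwoPeakonFlow.isSolution {a b s T : ℝ} (hs : s < 3 / 2) (hT : 0 < T)
    {p₁ p₂ q₁ q₂ dp₁ dp₂ dq₁ dq₂ : ℝ → ℝ} (h : TwoPeakonFlow a b T p₁ p₂ q₁ q₂ dp₁ dp₂ dq₁ dq₂) :
    IsSolution a b s T (superpose peakon (p₁ 0) (p₂ 0) (q₁ 0) (q₂ 0))
      fun t => superpose peakon (p₁ t) (p₂ t) (q₁ t) (q₂ t) where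
  continuous := continuousInHs_superpose hs h.peak₁.continuous_p h.peak₂.continuous_p
    h.peak₁.continuous_q h.peak₂.continuous_q
  initial := .rfl
  memL3 := memLp_superpose boundedMeasurable_peakon h.peak₁.continuous_p h.peak₂.continuous_p
    h.peak₁.continuous_q h.peak₂.continuous_q 3
  equation := ⟨_, memLp_superpose boundedMeasurable_peakonDeriv h.peak₁.continuous_p
    h.peak₂.continuous_p h.peak₁.continuous_q h.peak₂.continuous_q 3,
    .of_forall fun _ => isWeakDeriv_superpose _ _ _ _, h.equationHolds hT⟩

/-! ### Existence of the flows -/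

/-- The travelling peakon is accompanied by a ghost of momentum zero, kept half a period away so
that the peaks stay distinct. The speed laws carry a factor `p`, so they do not constrain the ghost.
-/
theorem twoPeakonFlow_single (a b T : ℝ) :
    TwoPeakonFlow a b T (fun _ => 0) (fun _ => 1) (fun t => peakSpeed a 1 0 π * t - π)
      (fun t => peakSpeed a 1 0 π * t) (fun _ => 0) (fun _ => 0) (fun _ => peakSpeed a 1 0 π)
      (fun _ => peakSpeed a 1 0 π) := by
  have hd : ∀ t, HasDerivAt (fun t => peakSpeed a 1 0 π * t) (peakSpeed a 1 0 π) t := fun t => by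
    simpa using (hasDerivAt_id t).const_mul (peakSpeed a 1 0 π)
  refine ⟨⟨by fun_prop, by fun_prop, by fun_prop, by fun_prop, fun t _ => hasDerivAt_const _ _,
      fun t _ => (hd t).sub_const π⟩,
    ⟨by fun_prop, by fun_prop, by fun_prop, by fun_prop, fun t _ => hasDerivAt_const _ _,
      fun t _ => hd t⟩, fun t _ => by linarith [pi_pos], fun t _ => by linarith [pi_pos],
    fun t _ => by simp, fun t _ => by simp, fun t _ => by simp [peakGrowth],
    fun t _ => by simp [peakGrowth]⟩

section Prod

variable {E F : Type*} [NormedAddCommGroup E] [NormedSpace ℝ E] [NormedAddCommGroup F]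
  [NormedSpace ℝ F] {f : ℝ → E × F} {f' : E × F} {t : ℝ}

theorem hasDerivAt_prod_fst (h : HasDerivAt f f' t) : HasDerivAt (fun t => (f t).1) f'.1 t :=
  (hasFDerivAt_fst (𝕜 := ℝ) (p := f t)).comp_hasDerivAt t h

theorem hasDerivAt_prod_snd (h : HasDerivAt f f' t) : HasDerivAt (fun t => (f t).2) f'.2 t :=
  (hasFDerivAt_snd (𝕜 := ℝ) (p := f t)).comp_hasDerivAt t h

end Prod

/-- The vector field of the peakon system, in the variables `(p₁, p₂, q₁, q₂)`. -/
noncomputable def peakonField (a b : ℝ) (z : ℝ × ℝ × ℝ × ℝ) : ℝ × ℝ × ℝ × ℝ :=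
  (-peakGrowth b z.1 z.2.1 (z.2.2.2 - z.2.2.1), peakGrowth b z.2.1 z.1 (z.2.2.2 - z.2.2.1),
    peakSpeed a z.1 z.2.1 (z.2.2.2 - z.2.2.1), peakSpeed a z.2.1 z.1 (z.2.2.2 - z.2.2.1))

theorem contDiff_peakonField (a b : ℝ) : ContDiff ℝ 1 (peakonField a b) := by
  unfold peakonField peakGrowth peakSpeed
  fun_prop

/-- Coinciding peaks have the same height, so the `u²` parts of the speeds cancel and only the
contribution of `-a u_x³` is left. This is why `a ≠ 0` is needed for the splitting. -/
theorem peakSpeed_sub_peakSpeed_zero (a p r : ℝ) :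
    peakSpeed a r p 0 - peakSpeed a p r 0 = 2 * sinh π ^ 2 * (a * (r ^ 2 - p ^ 2)) := by
  simp only [peakSpeed, sub_zero]
  ring

theorem eventually_pos_of_hasDerivAt {f : ℝ → ℝ} {f' x : ℝ} (hf : HasDerivAt f f' x) (h0 : f x = 0)
    (h : 0 < f') : ∀ᶠ t in 𝓝[>] x, 0 < f t := by
  have hs := (hasDerivAt_iff_tendsto_slope.1 hf).eventually (lt_mem_nhds h)
  filter_upwards [hs.filter_mono (nhdsWithin_mono x fun t ht => ne_of_gt ht),
    self_mem_nhdsWithin] with t ht hxt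
  rw [slope_def_field, h0, sub_zero] at ht
  exact (div_pos_iff_of_pos_right (sub_pos.2 hxt)).1 ht

/-- Two peaks at the same place separate, if the one to be on the right is the faster one. -/
theorem exists_splitting_flow {a p r : ℝ} (b : ℝ) (hp : p ≠ 0) (hr : r ≠ 0)
    (h : 0 < a * (r ^ 2 - p ^ 2)) :
    ∃ T > 0, ∃ p₁ p₂ q₁ q₂ dp₁ dp₂ dq₁ dq₂ : ℝ → ℝ,
      TwoPeakonFlow a b T p₁ p₂ q₁ q₂ dp₁ dp₂ dq₁ dq₂ ∧ p₁ 0 = p ∧ p₂ 0 = r ∧ q₁ 0 = 0 ∧ q₂ 0 = 0 ∧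
      p₁ T ≠ 0 ∧ p₂ T ≠ 0 ∧ q₁ T < q₂ T ∧ q₂ T < q₁ T + 2 * π := by
  -- The ODE is solved from the collision point itself: the field is written with `π - q` rather
  -- than `centred`, hence is smooth across `q = 0`.
  obtain ⟨α, hα0, ε, hε, hα⟩ :=
    (contDiff_peakonField a b).contDiffAt.exists_forall_mem_closedBall_exists_eq_forall_mem_Ioo_hasDerivAt₀
      (x₀ := (p, r, 0, 0)) 0
  rw [zero_sub, zero_add] at hα
  have hd0 := hα 0 ⟨by linarith, hε⟩
  have hc0 : ContinuousAt α 0 := hd0.continuousAt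
  have hq : HasDerivAt (fun t => (α t).2.2.2 - (α t).2.2.1)
      (2 * sinh π ^ 2 * (a * (r ^ 2 - p ^ 2))) 0 := by
    have h := hasDerivAt_prod_snd (hasDerivAt_prod_snd hd0)
    refine ((hasDerivAt_prod_snd h).sub (hasDerivAt_prod_fst h)).congr_deriv ?_
    rw [hα0, ← peakSpeed_sub_peakSpeed_zero]
    simp [peakonField]
  have hS : 0 < sinh π := sinh_pos_iff.2 pi_pos
  have hpos := eventually_pos_of_hasDerivAt hq (by simp [hα0]) (by positivity)
  have hlt : ∀ᶠ t in 𝓝 (0 : ℝ), (α t).2.2.2 - (α t).2.2.1 < 2 * π :=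
    hq.continuousAt.eventually_lt continuousAt_const (by simp [hα0, pi_pos])
  have hp' : ∀ᶠ t in 𝓝 (0 : ℝ), (α t).1 ≠ 0 := hc0.fst.eventually_ne (by simpa [hα0] using hp)
  have hr' : ∀ᶠ t in 𝓝 (0 : ℝ), (α t).2.1 ≠ 0 :=
    hc0.snd.fst.eventually_ne (by simpa [hα0] using hr)
  obtain ⟨δ, hδ, hsub⟩ := mem_nhdsGT_iff_exists_Ioo_subset.1
    (hpos.and (((hlt.and (hp'.and hr')).and (gt_mem_nhds hε)).filter_mono nhdsWithin_le_nhds))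
  have hδ0 : 0 < δ := hδ
  have hT : δ / 2 ∈ Set.Ioo 0 δ := ⟨by linarith, by linarith⟩
  have hTε : δ / 2 < ε := (hsub hT).2.2
  -- Halving `δ` makes the separation and the nonzero momenta hold at the end time `T` too, where
  -- the two solutions will be compared.
  set T := δ / 2 with hTdef
  -- `α` is controlled only on `(-ε, ε)`, whereas `MovingPeak` asks for continuity on the whole
  -- line; freezing time outside `[0, T]` provides it.
  let cl : ℝ → ℝ := fun t => max 0 (min T t)
  have hcl : Continuous cl := by fun_prop
  have hclmem : ∀ t, cl t ∈ Set.Ioo (-ε) ε := fun t =>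
    ⟨lt_of_lt_of_le (by linarith) (le_max_left _ _),
      max_lt hε ((min_le_left _ _).trans_lt hTε)⟩
  have hcleq : ∀ t ∈ Set.Icc 0 T, cl t = t := fun t ht => by
    simp only [cl]
    rw [min_eq_right ht.2, max_eq_right ht.1]
  have hβ : Continuous fun t => α (cl t) :=
    continuous_iff_continuousAt.2 fun t =>
      ((hα _ (hclmem t)).continuousAt).comp (f := cl) hcl.continuousAt
  have hF : Continuous fun t => peakonField a b (α (cl t)) :=
    (contDiff_peakonField a b).continuous.comp hβ
  have hdβ : ∀ t ∈ Set.Ioo 0 T, HasDerivAt (fun t => α (cl t)) (peakonField a b (α (cl t))) t := by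
    intro t ht
    rw [hcleq t (Set.Ioo_subset_Icc_self ht)]
    refine (hα t ⟨by linarith [ht.1], ht.2.trans hTε⟩).congr_of_eventuallyEq ?_
    filter_upwards [Ioo_mem_nhds ht.1 ht.2] with τ hτ
    rw [hcleq τ (Set.Ioo_subset_Icc_self hτ)]
  have hsep : ∀ t ∈ Set.Ioo 0 T, 0 < (α (cl t)).2.2.2 - (α (cl t)).2.2.1 ∧
      (α (cl t)).2.2.2 - (α (cl t)).2.2.1 < 2 * π := fun t ht => by
    rw [hcleq t (Set.Ioo_subset_Icc_self ht)]
    have := hsub (show t ∈ Set.Ioo 0 δ from ⟨ht.1, ht.2.trans hT.2⟩)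
    exact ⟨this.1, this.2.1.1⟩
  have h0 : α (cl 0) = (p, r, 0, 0) := by rw [hcleq 0 ⟨le_rfl, hT.1.le⟩, hα0]
  have hend : cl T = T := hcleq T ⟨hT.1.le, le_rfl⟩
  have hTmem := hsub hT
  refine ⟨T, hT.1, fun t => (α (cl t)).1, fun t => (α (cl t)).2.1, fun t => (α (cl t)).2.2.1,
    fun t => (α (cl t)).2.2.2, fun t => (peakonField a b (α (cl t))).1,
    fun t => (peakonField a b (α (cl t))).2.1, fun t => (peakonField a b (α (cl t))).2.2.1,
    fun t => (peakonField a b (α (cl t))).2.2.2, ?_, by simp only [h0], by simp only [h0],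
    by simp only [h0], by simp only [h0], ?_, ?_, ?_, ?_⟩
  · exact
      { peak₁ := ⟨hβ.fst, hβ.snd.snd.fst, hF.fst, hF.snd.snd.fst, fun t ht => hasDerivAt_prod_fst (hdβ t ht),
          fun t ht => hasDerivAt_prod_fst (hasDerivAt_prod_snd (hasDerivAt_prod_snd (hdβ t ht)))⟩
        peak₂ := ⟨hβ.snd.fst, hβ.snd.snd.snd, hF.snd.fst, hF.snd.snd.snd,
          fun t ht => hasDerivAt_prod_fst (hasDerivAt_prod_snd (hdβ t ht)),
          fun t ht => hasDerivAt_prod_snd (hasDerivAt_prod_snd (hasDerivAt_prod_snd (hdβ t ht)))⟩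
        lt := fun t ht => sub_pos.1 (hsep t ht).1
        lt_add := fun t ht => sub_lt_iff_lt_add'.1 (hsep t ht).2
        speed₁ := fun t _ => rfl
        speed₂ := fun t _ => rfl
        growth₁ := fun t _ => rfl
        growth₂ := fun t _ => rfl }
  · simpa only [hend] using hTmem.2.1.2.1
  · simpa only [hend] using hTmem.2.1.2.2
  · simpa only [hend] using sub_pos.1 hTmem.1
  · simpa only [hend] using sub_lt_iff_lt_add'.1 hTmem.2.1.1

/-! ### Non-uniqueness -/

/-- Two separate peakons of nonzero momenta are not a single peakon of momentum one. -/
theorem superpose_not_ae_eq_single {p₁ p₂ q₁ q₂ : ℝ} (hp₁ : p₁ ≠ 0) (hp₂ : p₂ ≠ 0) (h12 : q₁ < q₂)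
    (h21 : q₂ < q₁ + 2 * π) (q r : ℝ) :
    ¬ superpose peakon p₁ p₂ q₁ q₂ =ᵐ[volume] superpose peakon 0 1 q r := by
  intro h
  have hc : ∀ n : ℤ, p₁ * Complex.exp (-(n * Complex.I) * q₁) + p₂ * Complex.exp (-(n * Complex.I) * q₂)
      = Complex.exp (-(n * Complex.I) * r) := fun n => by
    have e := coeff_congr_ae h n
    rw [coeff_superpose, coeff_superpose, div_left_inj' (one_add_sq_ne_zero n)] at e
    have hS : ((sinh π / π : ℝ) : ℂ) ≠ 0 := by
      exact_mod_cast (div_pos (sinh_pos_iff.2 pi_pos) pi_pos).ne'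
    simpa using mul_left_cancel₀ hS e
  -- Two frequencies suffice. Frequency `0` gives the total momentum and frequency `-1` gives `p₁
  -- e^{iq₁} + p₂ e^{iq₂} = e^{ir}`.
  have hsum : p₁ + p₂ = 1 := by
    have := hc 0
    simp only [Int.cast_zero, zero_mul, neg_zero, Complex.exp_zero, mul_one] at this
    exact_mod_cast this
  have hexp : ∀ x : ℝ, Complex.exp (-(((-1 : ℤ) : ℂ) * Complex.I) * x)
      = Complex.cos x + Complex.sin x * Complex.I := fun x => by
    rw [← Complex.exp_mul_I]
    congr 1
    push_cast
    ring
  have h1 := hc (-1)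
  rw [hexp, hexp, hexp, ← Complex.ofReal_cos, ← Complex.ofReal_cos, ← Complex.ofReal_cos,
    ← Complex.ofReal_sin, ← Complex.ofReal_sin, ← Complex.ofReal_sin] at h1
  have hre := congrArg Complex.re h1
  have him := congrArg Complex.im h1
  simp only [Complex.add_re, Complex.mul_re, Complex.add_im, Complex.mul_im, Complex.ofReal_re,
    Complex.ofReal_im, Complex.I_re, Complex.I_im, mul_zero, mul_one, zero_mul, sub_zero, add_zero,
    zero_add] at hre him
  have hcos : cos (q₂ - q₁) = 1 := by
    -- Compare the squared modulus at frequency `-1`, which is `1`, with `(p₁ + p₂)² = 1`.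
    have key : 2 * (p₁ * p₂) * (cos (q₂ - q₁) - 1) = 0 := by
      have e : (p₁ * cos q₁ + p₂ * cos q₂) ^ 2 + (p₁ * sin q₁ + p₂ * sin q₂) ^ 2 = 1 := by
        rw [hre, him, cos_sq_add_sin_sq]
      rw [cos_sub]
      linear_combination e - p₁ ^ 2 * sin_sq_add_cos_sq q₁ - p₂ ^ 2 * sin_sq_add_cos_sq q₂
        - (p₁ + p₂ + 1) * hsum
    have := (mul_eq_zero.1 key).resolve_left (by positivity)
    linarith
  have := (cos_eq_one_iff_of_lt_of_lt (by linarith) (by linarith)).1 hcos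
  linarith

theorem exists_nonunique {a s p r : ℝ} (b : ℝ) (hs : s < 3 / 2) (hp : p ≠ 0) (hr : r ≠ 0)
    (hpr : p + r = 1) (h : 0 < a * (r ^ 2 - p ^ 2)) :
    ∃ (T : ℝ) (u₀ : ℝ → ℝ) (u v : ℝ → ℝ → ℝ),
      0 < T ∧ MemHs s u₀ ∧ IsSolution a b s T u₀ u ∧ IsSolution a b s T u₀ v ∧
      ∃ t ∈ Set.Icc 0 T, ¬ (u t =ᵐ[volume] v t) := by
  obtain ⟨T, hT, p₁, p₂, q₁, q₂, dp₁, dp₂, dq₁, dq₂, hflow, hp0, hr0, hq₁, hq₂, hpT, hrT, hlt, hlt'⟩ :=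
    exists_splitting_flow b hp hr h
  have hu := hflow.isSolution hs hT
  have hv := (twoPeakonFlow_single a b T).isSolution hs hT
  -- Both data are the peakon at the origin: the coinciding pair has total momentum `p + r = 1`, and
  -- the ghost contributes nothing.
  have e : superpose peakon (p₁ 0) (p₂ 0) (q₁ 0) (q₂ 0)
      = superpose peakon 0 1 (peakSpeed a 1 0 π * 0 - π) (peakSpeed a 1 0 π * 0) := by
    funext x
    rw [hp0, hr0, hq₁, hq₂, superpose, superpose, mul_zero, ← add_mul, hpr]
    ring
  rw [e] at hu
  exact ⟨T, _, _, _, hT, memHs_superpose hs _ _ _ _, hu, hv, T, ⟨hT.le, le_rfl⟩,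
    superpose_not_ae_eq_single hpT hrT hlt hlt' _ _⟩

end ABFamily

theorem theorem1 (a b s : ℝ) (ha : a ≠ 0) (hs : s < 3 / 2) :
    ∃ (T : ℝ) (u₀ : ℝ → ℝ) (u v : ℝ → ℝ → ℝ),
      0 < T ∧ ABFamily.MemHs s u₀ ∧
      ABFamily.IsSolution a b s T u₀ u ∧ ABFamily.IsSolution a b s T u₀ v ∧
      ∃ t ∈ Set.Icc 0 T, ¬ (u t =ᵐ[MeasureTheory.volume] v t) := by
  -- The momenta `2` and `-1` add up to `1` and have different squares; the sign of `a` decides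
  -- which peak goes to the right, so that `a (r² - p²) = 3 |a|`.
  rcases lt_or_gt_of_ne ha with ha | ha
  · exact ABFamily.exists_nonunique (p := 2) (r := -1) b hs (by norm_num) (by norm_num)
      (by norm_num) (by linarith)
  · exact ABFamily.exists_nonunique (p := -1) (r := 2) b hs (by norm_num) (by norm_num)
      (by norm_num) (by linarith)
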